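/- Setting. Let $Z=\mathrm{diag}(1,-1)$ and let $\mathcal U_\theta(X)=e^{-i\theta Z}Xe^{i\theta Z}$ be the noiseless single-qubit evolution. A noisy evolution of strength $p\ge 0$ (with constant $K$) is a family of single-qubit channels $\mathcal N_{\theta,p}$, $\theta\in\mathbb R$, differentiable in $\theta$, such that for every $\theta$ $$\|\mathcal N_{\theta,p}-\mathcal U_\theta\|_\diamond\le Kp,\qquad \|\partial_\theta(\mathcal N_{\theta,p}-\mathcal U_\theta)\|_\diamond\le Kp .$$ For an $N$-qubit state $\rho$ write $\rho_\theta=\mathcal N_{\theta,p}^{\otimes N}(\rho)$ and $\rho^{(0)}_\theta=\mathcal U_\theta^{\otimes N}(\rho)$. For a state $\sigma$ put $\langle A\rangle_\sigma=\mathrm{Tr}(\sigma A)$, $C_\sigma(A,B)=\tfrac12\langle AB+BA\rangle_\sigma-\langle A\rangle_\sigma\langle B\rangle_\sigma$ and $\langle\Delta A^2\rangle_\sigma=C_\sigma(A,A)$; for two groups of qubits $I,J$ put $C_\sigma(I;J)=\max|C_\sigma(A_I,A_J)|$ over operators $A_I$ acting inside $I$ and $A_J$ acting inside $J$ with operator norms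 $\|A_I\|=\|A_J\|=1$. The quantum Fisher information of a family of states is $\mathcal F(\sigma_\theta)=\mathrm{Tr}(\sigma_\theta L^2)$, where the Hermitian operator $L$ solves $\partial_\theta\sigma_\theta=\tfrac12(L\sigma_\theta+\sigma_\theta L)$. Theorem. For all constants $a,K>0$ there is a constant $c_{\rm no}>0$ such that for all constants $b,C\in\mathbb R$ and $s\in\mathbb N$ there are constants $c_1,c_2>0$ with the following property. Let $p\ge 0$, let $M<N$ with $Mp\le c_{\rm no}$, let $N$ qubits be partitioned into $N/M$ groups of $M$ qubits each, let $\rho$ be any state of the $N$ qubits, let $\mathcal N_{\theta,p}$ be a noisy evolution of strength $p$ with constant $K$, and let $\theta\in\mathbb R$. Suppose that for every group $I$ the reduced state $\rho^{(0)}_{I,\theta}$ of $\rho^{(0)}_\theta$ on $I$ satisfies $$aM^2\le\mathcal F\big(\rho^{(0)}_{I,\theta}\big)\le bM^2,$$ and that there is a set $\mathcal S_I$ of at most $s$ groups, containing $I$, with $$\sum_{J\notin\mathcal S_I}C_\rho(I;J)\le C M^{-2}.$$ Then there is an observable $\mathcal O=\sum_I\mathcal O_I$, where each $\mathcal O_I$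 is a Hermitian operator acting inside the group $I$, with $\langle\Delta\mathcal O^2\rangle_{\rho_\theta}>0$ and $$\mathcal F(\rho_\theta)\ \ge\ \frac{\big(\partial_\theta\langle\mathcal O\rangle_{\rho_\theta}\big)^2}{\langle\Delta\mathcal O^2\rangle_{\rho_\theta}},\qquad c_1NM\ \le\ \frac{\big(\partial_\theta\langle\mathcal O\rangle_{\rho_\theta}\big)^2}{\langle\Delta\mathcal O^2\rangle_{\rho_\theta}}\ \le\ c_2NM .$$ ($\mathcal O$ may depend on the given $\theta$, $p$, $\rho$ and the noise, but is held fixed when $\langle\mathcal O\rangle_{\rho_\theta}$ is differentiated.) -/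

import Mathlib

noncomputable section

namespace NoisyMetrology

open scoped ComplexOrder

/-- A density matrix: positive semidefinite with unit trace. -/
def IsState {n : Type*} [Fintype n] (ρ : Matrix n n ℂ) : Prop :=
  ρ.PosSemidef ∧ ρ.trace = 1

/-- The operator norm (largest singular value) of a matrix. -/
def opNorm {n : Type*} [Fintype n] [DecidableEq n] (A : Matrix n n ℂ) : ℝ :=
  ‖Matrix.toEuclideanCLM (𝕜 := ℂ) A‖

/-- The trace norm `Tr √(X† X)`: the sum of the singular values of `X`. -/
def traceNorm {n : Type*} [Fintype n] [DecidableEq n] (X : Matrix n n ℂ) : ℝ :=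
  ∑ i, √((Matrix.isHermitian_conjTranspose_mul_self X).eigenvalues i)

/-- The expectation `⟨A⟩_σ = Tr (σ A)`. -/
def expect {n : Type*} [Fintype n] (σ A : Matrix n n ℂ) : ℂ := (σ * A).trace

/-- The symmetrized correlation `C_σ(A, B) = ⟨AB + BA⟩_σ / 2 - ⟨A⟩_σ ⟨B⟩_σ`. -/
def corr {n : Type*} [Fintype n] (σ A B : Matrix n n ℂ) : ℂ :=
  expect σ (A * B + B * A) / 2 - expect σ A * expect σ B

/-- The variance `C_σ(A, A)` (a real number for a state and a Hermitian observable). -/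
def variance {n : Type*} [Fintype n] (σ A : Matrix n n ℂ) : ℝ := (corr σ A A).re

/-- `L` is a symmetric logarithmic derivative at `θ` of the family `ρ`:
it is Hermitian and `∂_θ ρ = (L ρ + ρ L) / 2` (the derivative is taken entrywise). -/
def IsSLD {n : Type*} [Fintype n] (ρ : ℝ → Matrix n n ℂ) (θ : ℝ) (L : Matrix n n ℂ) : Prop :=
  L.IsHermitian ∧
    ∀ i j, HasDerivAt (fun t => ρ t i j) (((1 / 2 : ℂ) • (L * ρ θ + ρ θ * L)) i j) θ

/-- The family `ρ` has quantum Fisher information `F` at `θ`: `F = Tr (ρ_θ L ^ 2)` for a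
symmetric logarithmic derivative `L`. -/
def HasQFI {n : Type*} [Fintype n] (ρ : ℝ → Matrix n n ℂ) (θ F : ℝ) : Prop :=
  ∃ L, IsSLD ρ θ L ∧ (expect (ρ θ) (L * L)).re = F

/-- The quantum Fisher information does not depend on the choice of `L`. -/
theorem HasQFI.unique {n : Type*} [Fintype n] {ρ : ℝ → Matrix n n ℂ} {θ F F' : ℝ}
    (h : HasQFI ρ θ F) (h' : HasQFI ρ θ F') : F = F' := by
  obtain ⟨L, ⟨-, hL⟩, rfl⟩ := h
  obtain ⟨K, ⟨-, hK⟩, rfl⟩ := h'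
  have key : L * ρ θ + ρ θ * L = K * ρ θ + ρ θ * K := by
    ext i j
    have := (hL i j).unique (hK i j)
    simpa using this
  have e1 : (ρ θ * (L * L)).trace + (ρ θ * (L * L)).trace
      = ((L * ρ θ + ρ θ * L) * L).trace := by
    rw [add_mul, Matrix.trace_add, Matrix.mul_assoc, Matrix.trace_mul_comm L, Matrix.mul_assoc]
  have e2 : (ρ θ * (K * K)).trace + (ρ θ * (K * K)).trace
      = ((K * ρ θ + ρ θ * K) * K).trace := by
    rw [add_mul, Matrix.trace_add, Matrix.mul_assoc, Matrix.trace_mul_comm K, Matrix.mul_assoc]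
  have e3 : ((K * ρ θ + ρ θ * K) * L).trace = ((L * ρ θ + ρ θ * L) * K).trace := by
    rw [add_mul, add_mul, Matrix.trace_add, Matrix.trace_add, add_comm]
    congr 1
    · rw [Matrix.mul_assoc, Matrix.trace_mul_comm, Matrix.mul_assoc, Matrix.trace_mul_comm,
        Matrix.mul_assoc, Matrix.trace_mul_comm, Matrix.mul_assoc]
    · rw [Matrix.mul_assoc, Matrix.trace_mul_comm]
  have e4 : (ρ θ * (L * L)).trace = (ρ θ * (K * K)).trace := by
    have : (ρ θ * (L * L)).trace + (ρ θ * (L * L)).trace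
        = (ρ θ * (K * K)).trace + (ρ θ * (K * K)).trace := by
      rw [e1, e2, key, e3, key]
    linear_combination (1 / 2 : ℂ) * this
  simp only [expect, e4]

/-- A linear map on the operators of a single qubit. -/
abbrev QubitMap := Matrix (Fin 2) (Fin 2) ℂ →ₗ[ℂ] Matrix (Fin 2) (Fin 2) ℂ

/-- `(Φ ⊗ id)(X)`, where `Φ` acts on the qubit and `id` on a `k`-dimensional ancilla. -/
def ampliate (Φ : QubitMap) (k : ℕ) (X : Matrix (Fin 2 × Fin k) (Fin 2 × Fin k) ℂ) :
    Matrix (Fin 2 × Fin k) (Fin 2 × Fin k) ℂ :=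
  Matrix.of fun x y => Φ (Matrix.of fun a b => X (a, x.2) (b, y.2)) x.1 y.1

/-- A quantum channel: a completely positive trace-preserving map. -/
def IsChannel (Φ : QubitMap) : Prop :=
  (∀ (k : ℕ) (X : Matrix (Fin 2 × Fin k) (Fin 2 × Fin k) ℂ),
      X.PosSemidef → (ampliate Φ k X).PosSemidef) ∧
    ∀ X, (Φ X).trace = X.trace

/-- The diamond norm: the supremum of `‖(Φ ⊗ id)(X)‖₁` over all finite-dimensional ancillas and
all operators `X` of trace norm at most `1`. -/
def diamondNorm (Φ : QubitMap) : ENNReal :=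
  ⨆ (k : ℕ) (X : Matrix (Fin 2 × Fin k) (Fin 2 × Fin k) ℂ) (_ : traceNorm X ≤ 1),
    ENNReal.ofReal (traceNorm (ampliate Φ k X))

/-- The matrix `e^{-iθZ}`. -/
def rotMatrix (θ : ℝ) : Matrix (Fin 2) (Fin 2) ℂ :=
  Matrix.diagonal ![Complex.exp (-(θ * Complex.I)), Complex.exp (θ * Complex.I)]

/-- The noiseless evolution `X ↦ e^{-iθZ} X e^{iθZ}` of a qubit. -/
def zRotation (θ : ℝ) : QubitMap where
  toFun X := rotMatrix θ * X * (rotMatrix θ).conjTranspose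
  map_add' X Y := by rw [mul_add, add_mul]
  map_smul' c X := by simp

/-- A `θ`-dependent single-qubit channel `𝒩_θ` with noise strength `p`: it is within `K p`
of the noiseless evolution in diamond norm, and so are the `θ`-derivatives. -/
def IsNoisyEvolution (K p : ℝ) (𝒩 : ℝ → QubitMap) : Prop :=
  ∀ θ, IsChannel (𝒩 θ) ∧
    diamondNorm (𝒩 θ - zRotation θ) ≤ ENNReal.ofReal (K * p) ∧
    ∃ D : QubitMap,
      (∀ X a b, HasDerivAt (fun t => (𝒩 t - zRotation t) X a b) (D X a b) θ) ∧
      diamondNorm D ≤ ENNReal.ofReal (K * p)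

/-- `(Φ ⊗ ⋯ ⊗ Φ)(ρ)`, one factor for each of the qubits in `Λ`; the computational basis of these
qubits is indexed by `Λ → Fin 2`. -/
def tensorPower {Λ : Type*} [Fintype Λ] [DecidableEq Λ] (Φ : QubitMap)
    (ρ : Matrix (Λ → Fin 2) (Λ → Fin 2) ℂ) : Matrix (Λ → Fin 2) (Λ → Fin 2) ℂ :=
  Matrix.of fun x y =>
    ∑ u, ∑ v, (∏ i, Φ (Matrix.single (u i) (v i) 1) (x i) (y i)) * ρ u v

/-- The index type of the computational basis of group `I`, for qubits grouped by `grp`. -/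
abbrev GroupBasis {Λ Γ : Type*} (grp : Λ → Γ) (I : Γ) := {i : Λ // grp i = I} → Fin 2

/-- The operator `A` on group `I`, tensored with the identity on all the other qubits. -/
def embed {Λ Γ : Type*} [Fintype Λ] [DecidableEq Γ] (grp : Λ → Γ) (I : Γ)
    (A : Matrix (GroupBasis grp I) (GroupBasis grp I) ℂ) :
    Matrix (Λ → Fin 2) (Λ → Fin 2) ℂ :=
  Matrix.of fun x y =>
    if ∀ i, grp i ≠ I → x i = y i then A (fun i => x i) (fun i => y i) else 0

/-- The reduced density matrix of group `I`: the partial trace over all the other qubits. -/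
def reduced {Λ Γ : Type*} [Fintype Λ] [DecidableEq Λ] [DecidableEq Γ] (grp : Λ → Γ) (I : Γ)
    (ρ : Matrix (Λ → Fin 2) (Λ → Fin 2) ℂ) :
    Matrix (GroupBasis grp I) (GroupBasis grp I) ℂ :=
  Matrix.of fun s t => ∑ u : {i : Λ // ¬ grp i = I} → Fin 2,
    ρ ((Equiv.piEquivPiSubtypeProd (fun i => grp i = I) (fun _ => Fin 2)).symm (s, u))
      ((Equiv.piEquivPiSubtypeProd (fun i => grp i = I) (fun _ => Fin 2)).symm (t, u))

/-- The correlation between two groups, `C_σ(I; J) = max |C_σ(A, B)|` over operators `A` inside `I`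
and `B` inside `J` of operator norm `1`. -/
def groupCorr {Λ Γ : Type*} [Fintype Λ] [DecidableEq Λ] [DecidableEq Γ] (grp : Λ → Γ)
    (σ : Matrix (Λ → Fin 2) (Λ → Fin 2) ℂ) (I J : Γ) : ℝ :=
  sSup {r | ∃ (A : Matrix (GroupBasis grp I) (GroupBasis grp I) ℂ)
      (B : Matrix (GroupBasis grp J) (GroupBasis grp J) ℂ),
    opNorm A = 1 ∧ opNorm B = 1 ∧ r = ‖corr σ (embed grp I A) (embed grp J B)‖}

end NoisyMetrology

end

/-! Each group carries a Hermitian contraction `O_I` whose expectation moves at a speed of order M.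
There are N/M groups, so the speed of the sum is of order N; the weak correlations between groups
keep its variance of order N/M. The ratio is then of order N²/(N/M) = NM.

Local observable. On one group let H = ∑ Z_i, so ‖H‖ ≤ m = M, and let S be the square root of the
noiseless state σ. The Fisher information is at most 4‖[H, S]‖² in Hilbert-Schmidt norm
(`fisher_le_frobSq_diagComm`). With U the Cayley transform of H/m, the Powers-Størmer inequality
bounds ‖S - USU†‖² by Tr E(σ - UσU†) for some -1 ≤ E ≤ 1. For R = (1 - iH/m)⁻¹ the identity X - UXU†
= (2/m) R(-i[H, X])R† is exact, so both sides become commutators and R†ER moves at speed at least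
F/(8m) ≥ aM/8 (`exists_observable_of_fisher`).

Noise. Replacing the noiseless maps qubit by qubit changes this speed by O(M²Kp), a small fraction
of aM once Mp is below the threshold (`IsNoisyEvolution.exists_hasDerivAt`). The telescoping needs
norm bounds that multiply under tensor products; `Factors` supplies them.

Variance. The noise acts on each qubit separately, so in the Heisenberg picture it sends Hermitian
contractions inside a group to contractions inside the same group. Correlations of the `O_I` in the
noisy state are therefore bounded by the group correlations of ρ (`IsKraus.corr_tensorPower`).

Comparison and upper bound. The Cramér-Rao inequality bounds the ratio by the Fisher information and
also forces the variance v to be positive. Up to a factor 2 the speed is at most Tr(-i[H, ρ]Y),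
where Y is the Heisenberg image of the observable and H now runs over all N qubits. Robertson's
relation bounds this trace by 2√(Var H · Var Y) in ρ; Var H is O(NM) by the same correlation
estimate, and Var Y ≤ v by Kadison-Schwarz. -/

noncomputable section
namespace NoisyMetrology
open scoped ComplexOrder Kronecker
set_option linter.unusedSectionVars false

/-! ### Tensor products of qubit operators and of qubit maps. -/

section

variable {Λ : Type*} [Fintype Λ] [DecidableEq Λ]

/-- The product operator `⨂ a i`. -/
def kron (a : Λ → Matrix (Fin 2) (Fin 2) ℂ) : Matrix (Λ → Fin 2) (Λ → Fin 2) ℂ :=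
  Matrix.of fun x y => ∏ i, a i (x i) (y i)

/-- `(⨂ Ψ i)(ρ)`, with a possibly different map on each qubit. -/
def tensorMap (Ψ : Λ → QubitMap) (ρ : Matrix (Λ → Fin 2) (Λ → Fin 2) ℂ) :
    Matrix (Λ → Fin 2) (Λ → Fin 2) ℂ :=
  Matrix.of fun x y =>
    ∑ u, ∑ v, (∏ i, Ψ i (Matrix.single (u i) (v i) 1) (x i) (y i)) * ρ u v

theorem tensorPower_eq_tensorMap (Φ : QubitMap) (ρ : Matrix (Λ → Fin 2) (Λ → Fin 2) ℂ) :
    tensorPower Φ ρ = tensorMap (fun _ => Φ) ρ := rfl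

theorem kron_mul (a b : Λ → Matrix (Fin 2) (Fin 2) ℂ) :
    kron a * kron b = kron fun i => a i * b i := by
  ext x y
  simp only [kron, Matrix.mul_apply, Matrix.of_apply, ← Finset.prod_mul_distrib]
  rw [Finset.prod_univ_sum, Fintype.piFinset_univ]

theorem kron_conjTranspose (a : Λ → Matrix (Fin 2) (Fin 2) ℂ) :
    (kron a).conjTranspose = kron fun i => (a i).conjTranspose := by
  ext x y
  simp [kron, Matrix.conjTranspose_apply]

theorem kron_smul_one (c : Λ → ℂ) :
    kron (fun i => c i • (1 : Matrix (Fin 2) (Fin 2) ℂ)) = (∏ i, c i) • 1 := by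
  ext x y
  simp only [kron, Matrix.of_apply, Matrix.smul_apply, smul_eq_mul, Finset.prod_mul_distrib]
  congr 1
  by_cases h : x = y
  · subst h; simp
  · obtain ⟨i, hi⟩ := Function.ne_iff.1 h
    rw [Matrix.one_apply_ne h]
    exact Finset.prod_eq_zero (Finset.mem_univ i) (Matrix.one_apply_ne hi)

theorem kron_one : kron (fun _ : Λ => (1 : Matrix (Fin 2) (Fin 2) ℂ)) = 1 := by
  simpa using kron_smul_one (fun _ : Λ => (1 : ℂ))

theorem sum_kron {n : Λ → ℕ} (A : ∀ i, Fin (n i) → Matrix (Fin 2) (Fin 2) ℂ) :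
    ∑ k : (∀ i, Fin (n i)), kron (fun i => A i (k i)) = kron fun i => ∑ k, A i k := by
  ext x y
  simp only [kron, Matrix.sum_apply, Matrix.of_apply]
  rw [Finset.prod_univ_sum, Fintype.piFinset_univ]

theorem single_eq_kron (x y : Λ → Fin 2) :
    Matrix.single x y (1 : ℂ) = kron fun i => Matrix.single (x i) (y i) (1 : ℂ) := by
  ext u v
  simp only [kron, Matrix.of_apply, Matrix.single_apply]
  rw [Finset.prod_ite_zero]
  simp only [funext_iff, Finset.mem_univ, true_implies, Finset.prod_const_one, forall_and]

/-- Linearity in a single tensor factor, the algebra behind telescoping. -/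
theorem tensorMap_update_sub (Ψ : Λ → QubitMap) (i : Λ) (α β : QubitMap)
    (ρ : Matrix (Λ → Fin 2) (Λ → Fin 2) ℂ) :
    tensorMap (Function.update Ψ i (α - β)) ρ =
      tensorMap (Function.update Ψ i α) ρ - tensorMap (Function.update Ψ i β) ρ := by
  ext x y
  simp only [tensorMap, Matrix.of_apply, Matrix.sub_apply, ← Finset.sum_sub_distrib, ← sub_mul]
  refine Finset.sum_congr rfl fun u _ => Finset.sum_congr rfl fun v _ => ?_
  congr 1
  rw [← Finset.mul_prod_erase _ _ (Finset.mem_univ i), ← Finset.mul_prod_erase _ _ (Finset.mem_univ i),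
    ← Finset.mul_prod_erase _ _ (Finset.mem_univ i)]
  have h : ∀ γ : QubitMap, ∏ j ∈ Finset.univ.erase i,
      (Function.update Ψ i γ j) (Matrix.single (u j) (v j) 1) (x j) (y j) =
      ∏ j ∈ Finset.univ.erase i, Ψ j (Matrix.single (u j) (v j) 1) (x j) (y j) := fun γ =>
    Finset.prod_congr rfl fun j hj => by rw [Function.update_of_ne (Finset.ne_of_mem_erase hj)]
  rw [h, h, h]
  simp [sub_mul]

/-- Expanding the product of the one-qubit sums gives a sum over choice functions `k` of product
operators. Two different families `A`, `B` are allowed because differences and derivatives of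
channels need not be completely positive. -/
theorem tensorMap_eq_sum {n : Λ → ℕ} {Ψ : Λ → QubitMap}
    {A B : ∀ i, Fin (n i) → Matrix (Fin 2) (Fin 2) ℂ}
    (h : ∀ i X, Ψ i X = ∑ k, A i k * X * (B i k).conjTranspose)
    (ρ : Matrix (Λ → Fin 2) (Λ → Fin 2) ℂ) :
    tensorMap Ψ ρ = ∑ k : (∀ i, Fin (n i)),
      kron (fun i => A i (k i)) * ρ * (kron fun i => B i (k i)).conjTranspose := by
  have hs : ∀ i (u v x y : Fin 2), Ψ i (Matrix.single u v 1) x y =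
      ∑ k, A i k x u * star (B i k y v) := by
    intro i u v x y
    rw [h, Matrix.sum_apply]
    refine Finset.sum_congr rfl fun k _ => ?_
    simp [Matrix.mul_apply, Matrix.single_apply, ite_and, Finset.sum_ite_eq]
  ext x y
  simp only [tensorMap, Matrix.of_apply, hs, Matrix.sum_apply]
  simp_rw [Finset.prod_univ_sum, Fintype.piFinset_univ]
  simp only [Matrix.mul_apply, kron, Matrix.of_apply, Matrix.conjTranspose_apply, Finset.sum_mul,
    star_prod, Finset.prod_mul_distrib]
  rw [Finset.sum_comm]
  conv_rhs => rw [Finset.sum_comm]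
  refine Finset.sum_congr rfl fun v _ => ?_
  rw [Finset.sum_comm]
  refine Finset.sum_congr rfl fun u _ => Finset.sum_congr rfl fun k _ => by ring

end

/-! ### Square roots, the Hilbert-Schmidt inner product and operator-norm contractions. -/

section MatrixTools

variable {n : Type*} [Fintype n] [DecidableEq n]

theorem exists_diagonalization {A : Matrix n n ℂ} (hA : A.IsHermitian) :
    ∃ (V : Matrix n n ℂ) (μ : n → ℝ), V.conjTranspose * V = 1 ∧ V * V.conjTranspose = 1 ∧
      A = V * Matrix.diagonal (fun i => (μ i : ℂ)) * V.conjTranspose ∧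
      (A.PosSemidef → ∀ i, 0 ≤ μ i) := by
  refine ⟨hA.eigenvectorUnitary, hA.eigenvalues, ?_, ?_, ?_, fun h i => h.eigenvalues_nonneg i⟩
  · exact Unitary.coe_star_mul_self _
  · exact Unitary.coe_mul_star_self _
  · conv_lhs => rw [hA.spectral_theorem, Unitary.conjStarAlgAut_apply]
    rfl

theorem posSemidef_diagonal_ofReal {μ : n → ℝ} (h : ∀ i, 0 ≤ μ i) :
    (Matrix.diagonal (fun i => (μ i : ℂ))).PosSemidef :=
  Matrix.PosSemidef.diagonal fun i => by simpa using h i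

theorem exists_posSemidef_sqrt {σ : Matrix n n ℂ} (h : σ.PosSemidef) :
    ∃ S : Matrix n n ℂ, S.PosSemidef ∧ S * S = σ := by
  obtain ⟨V, μ, h1, -, h3, h4⟩ := exists_diagonalization h.1
  refine ⟨V * Matrix.diagonal (fun i => ((√(μ i) : ℝ) : ℂ)) * V.conjTranspose,
    (posSemidef_diagonal_ofReal fun i => Real.sqrt_nonneg _).mul_mul_conjTranspose_same V, ?_⟩
  conv_rhs => rw [h3]
  have : Matrix.diagonal (fun i => ((√(μ i) : ℝ) : ℂ)) * Matrix.diagonal (fun i => ((√(μ i) : ℝ) : ℂ))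
      = Matrix.diagonal (fun i => (μ i : ℂ)) := by
    rw [Matrix.diagonal_mul_diagonal]
    congr 1; ext i
    rw [← Complex.ofReal_mul, Real.mul_self_sqrt (h4 h i)]
  rw [← this]
  simp only [Matrix.mul_assoc]
  rw [← Matrix.mul_assoc V.conjTranspose V, h1, Matrix.one_mul]

/-- The square of the Hilbert-Schmidt norm. -/
def frobSq (X : Matrix n n ℂ) : ℝ := ∑ i, ∑ j, ‖X i j‖ ^ 2

theorem frobSq_nonneg (X : Matrix n n ℂ) : 0 ≤ frobSq X :=
  Finset.sum_nonneg fun _ _ => Finset.sum_nonneg fun _ _ => sq_nonneg _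

theorem trace_conjTranspose_mul (X Y : Matrix n n ℂ) :
    (X.conjTranspose * Y).trace = ∑ i, ∑ j, star (X i j) * Y i j := by
  simp only [Matrix.trace, Matrix.diag_apply, Matrix.mul_apply, Matrix.conjTranspose_apply]
  rw [Finset.sum_comm]

theorem trace_conjTranspose_mul_self (X : Matrix n n ℂ) :
    (X.conjTranspose * X).trace = (frobSq X : ℂ) := by
  rw [trace_conjTranspose_mul, frobSq]
  push_cast
  refine Finset.sum_congr rfl fun i _ => Finset.sum_congr rfl fun j _ => ?_
  rw [← Complex.conj_mul']
  rfl

/-- Cauchy-Schwarz for the Hilbert-Schmidt inner product on a direct sum of copies of the matrix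
space. -/
theorem norm_sum_trace_sq_le {ι : Type*} [Fintype ι] (X Y : ι → Matrix n n ℂ) :
    ‖∑ k, ((X k).conjTranspose * Y k).trace‖ ^ 2 ≤ (∑ k, frobSq (X k)) * ∑ k, frobSq (Y k) := by
  have e : ∀ Z : ι → Matrix n n ℂ, ∑ k, frobSq (Z k) =
      ∑ q : ι × n × n, ‖Z q.1 q.2.1 q.2.2‖ ^ 2 := fun Z => by
    simp only [frobSq, Fintype.sum_prod_type]
  have e2 : ∑ k, ((X k).conjTranspose * Y k).trace =
      ∑ q : ι × n × n, star (X q.1 q.2.1 q.2.2) * Y q.1 q.2.1 q.2.2 := by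
    simp only [trace_conjTranspose_mul, Fintype.sum_prod_type]
  rw [e, e, e2]
  refine le_trans ?_ (Finset.sum_mul_sq_le_sq_mul_sq _ _ _)
  gcongr
  refine (norm_sum_le _ _).trans (le_of_eq ?_)
  simp

theorem norm_trace_sq_le (X Y : Matrix n n ℂ) :
    ‖(X.conjTranspose * Y).trace‖ ^ 2 ≤ frobSq X * frobSq Y := by
  simpa using norm_sum_trace_sq_le (fun _ : Unit => X) (fun _ => Y)

theorem opNorm_conjTranspose (A : Matrix n n ℂ) : opNorm A.conjTranspose = opNorm A := by
  open scoped Matrix.Norms.L2Operator in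
  exact Matrix.l2_opNorm_conjTranspose A

theorem dotProduct_star_self (x : n → ℂ) :
    star x ⬝ᵥ x = ((‖(WithLp.toLp 2 x : EuclideanSpace ℂ n)‖ ^ 2 : ℝ) : ℂ) := by
  rw [EuclideanSpace.norm_sq_eq]
  simp only [dotProduct, Pi.star_apply]
  push_cast
  refine Finset.sum_congr rfl fun j _ => ?_
  rw [← Complex.conj_mul']
  rfl

theorem star_dotProduct_one_sub (A : Matrix n n ℂ) (x : n → ℂ) :
    star x ⬝ᵥ ((1 - A.conjTranspose * A).mulVec x) =
      ((‖(WithLp.toLp 2 x : EuclideanSpace ℂ n)‖ ^ 2 -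
        ‖(WithLp.toLp 2 (A.mulVec x) : EuclideanSpace ℂ n)‖ ^ 2 : ℝ) : ℂ) := by
  rw [Matrix.sub_mulVec, Matrix.one_mulVec, dotProduct_sub, ← Matrix.mulVec_mulVec,
    Matrix.dotProduct_mulVec, ← Matrix.star_mulVec, dotProduct_star_self, dotProduct_star_self]
  push_cast; rfl

/-- Phrasing the norm bound as positivity makes it stable under tensoring with the identity, as
needed in `opNorm_embed_le_one`. -/
theorem opNorm_le_one_iff {A : Matrix n n ℂ} :
    opNorm A ≤ 1 ↔ (1 - A.conjTranspose * A).PosSemidef := by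
  constructor
  · intro h
    refine Matrix.PosSemidef.of_dotProduct_mulVec_nonneg ?_ fun x => ?_
    · exact Matrix.isHermitian_one.sub (Matrix.isHermitian_conjTranspose_mul_self A)
    · rw [star_dotProduct_one_sub]
      have h1 := (Matrix.toEuclideanCLM (𝕜 := ℂ) A).le_opNorm (WithLp.toLp 2 x)
      rw [Matrix.toEuclideanCLM_toLp] at h1
      have h2 : ‖(WithLp.toLp 2 (A.mulVec x) : EuclideanSpace ℂ n)‖ ≤
          ‖(WithLp.toLp 2 x : EuclideanSpace ℂ n)‖ :=
        h1.trans (mul_le_of_le_one_left (norm_nonneg _) h)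
      have : 0 ≤ ‖(WithLp.toLp 2 x : EuclideanSpace ℂ n)‖ ^ 2 -
        ‖(WithLp.toLp 2 (A.mulVec x) : EuclideanSpace ℂ n)‖ ^ 2 := by
        have := pow_le_pow_left₀ (norm_nonneg _) h2 2
        linarith
      exact_mod_cast this
  · intro h
    refine ContinuousLinearMap.opNorm_le_bound _ zero_le_one fun x => ?_
    have h1 := h.dotProduct_mulVec_nonneg x.ofLp
    rw [star_dotProduct_one_sub] at h1
    have h2 : 0 ≤ ‖x‖ ^ 2 - ‖(WithLp.toLp 2 (A.mulVec x.ofLp) : EuclideanSpace ℂ n)‖ ^ 2 := by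
      exact_mod_cast h1
    rw [one_mul]
    have h3 : Matrix.toEuclideanCLM (𝕜 := ℂ) A x = WithLp.toLp 2 (A.mulVec x.ofLp) := by
      rw [← Matrix.toEuclideanCLM_toLp]
    rw [h3]
    exact le_of_sq_le_sq (by linarith) (norm_nonneg _)

/-- The order form -1 ≤ A ≤ 1 is the one preserved by positive unital maps, so contractions are
tracked this way. The bound A² ≤ 1 comes from writing 2(1 - A²) as a sum of two conjugates of
positive matrices. -/
theorem opNorm_le_one_of_abs_le_one {A : Matrix n n ℂ} (hm : (1 - A).PosSemidef)
    (hp : (1 + A).PosSemidef) : opNorm A ≤ 1 := by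
  have hA : A.IsHermitian := by
    have := hp.1.sub (Matrix.isHermitian_one (n := n) (α := ℂ))
    simpa using this
  rw [opNorm_le_one_iff, hA.eq]
  have h1 := hm.mul_mul_conjTranspose_same (1 + A)
  have h2 := hp.mul_mul_conjTranspose_same (1 - A)
  rw [hp.1.eq] at h1
  rw [hm.1.eq] at h2
  have h3 := (h1.add h2).smul (show (0 : ℝ) ≤ 1 / 2 by norm_num)
  convert h3 using 1
  rw [eq_comm, ← sub_eq_zero]
  have : (1 + A) * (1 - A) * (1 + A) + (1 - A) * (1 + A) * (1 - A) = (2 : ℝ) • (1 - A * A) := by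
    rw [two_smul]; noncomm_ring
  rw [this, smul_smul]; norm_num

/-- The basic Cauchy-Schwarz estimate for maps of the form `ρ ↦ ∑ A ρ B†`. -/
theorem norm_expect_sum_le {ι : Type*} [Fintype ι] {ρ O : Matrix n n ℂ} (hρ : IsState ρ)
    (hO : opNorm O ≤ 1) {A B : ι → Matrix n n ℂ} {c : ℝ} (hc : 0 ≤ c)
    (hA : ∑ k, (A k).conjTranspose * A k = (c : ℂ) • 1)
    (hB : ∑ k, (B k).conjTranspose * B k = (c : ℂ) • 1) :
    ‖expect (∑ k, A k * ρ * (B k).conjTranspose) O‖ ≤ c := by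
  obtain ⟨S, hS, rfl⟩ := exists_posSemidef_sqrt hρ.1
  have hSt : ((S * S).trace).re = 1 := by rw [hρ.2]; rfl
  -- With ρ = S², the normalisation of the family makes its total Hilbert-Schmidt weight against `S`
  -- exactly `c`, since Tr ρ = 1.
  have key : ∀ D : ι → Matrix n n ℂ, ∑ k, (D k).conjTranspose * D k = (c : ℂ) • 1 →
      ∑ k, frobSq (D k * S) = c := by
    intro D hD
    have : ((∑ k, frobSq (D k * S) : ℝ) : ℂ) = c := by
      push_cast
      simp_rw [← trace_conjTranspose_mul_self, Matrix.conjTranspose_mul, hS.1.eq, Matrix.mul_assoc]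
      rw [← Matrix.trace_sum, ← Matrix.mul_sum]
      simp_rw [← Matrix.mul_assoc (D _).conjTranspose]
      rw [← Matrix.sum_mul, hD, Matrix.smul_mul, Matrix.one_mul, Matrix.mul_smul,
        Matrix.trace_smul, hρ.2]
      simp
    exact_mod_cast this
  have e : expect (∑ k, A k * (S * S) * (B k).conjTranspose) O =
      ∑ k, ((O.conjTranspose * (B k * S)).conjTranspose * (A k * S)).trace := by
    rw [expect, Matrix.sum_mul, Matrix.trace_sum]
    refine Finset.sum_congr rfl fun k _ => ?_
    rw [Matrix.conjTranspose_mul, Matrix.conjTranspose_conjTranspose, Matrix.conjTranspose_mul,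
      hS.1.eq, Matrix.trace_mul_comm _ (A k * S)]
    simp only [Matrix.mul_assoc]
  have hle : ∀ k, frobSq (O.conjTranspose * (B k * S)) ≤ frobSq (B k * S) := by
    intro k
    have h1 : (1 - O.conjTranspose.conjTranspose * O.conjTranspose).PosSemidef := by
      rw [← opNorm_le_one_iff, opNorm_conjTranspose]; exact hO
    have h2 := (h1.conjTranspose_mul_mul_same (B k * S)).trace_nonneg
    have h3 : ((B k * S).conjTranspose * (1 - O.conjTranspose.conjTranspose * O.conjTranspose) *
        (B k * S)).trace = ((frobSq (B k * S) - frobSq (O.conjTranspose * (B k * S)) : ℝ) : ℂ) := by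
      push_cast
      rw [← trace_conjTranspose_mul_self, ← trace_conjTranspose_mul_self, ← Matrix.trace_sub,
        Matrix.conjTranspose_mul O.conjTranspose]
      congr 1
      noncomm_ring
    rw [h3] at h2
    have : 0 ≤ frobSq (B k * S) - frobSq (O.conjTranspose * (B k * S)) := by exact_mod_cast h2
    linarith
  have h := norm_sum_trace_sq_le (fun k => O.conjTranspose * (B k * S)) (fun k => A k * S)
  rw [key A hA] at h
  rw [e]
  have hB' := key B hB
  have hs : ∑ k, frobSq (O.conjTranspose * (B k * S)) ≤ c :=
    (Finset.sum_le_sum fun k _ => hle k).trans hB'.le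
  refine le_of_sq_le_sq ?_ hc
  calc _ ≤ _ := h
    _ ≤ c * c := by gcongr
    _ = c ^ 2 := by ring

theorem norm_expect_le {ρ O : Matrix n n ℂ} (hρ : IsState ρ) (hO : opNorm O ≤ 1) :
    ‖expect ρ O‖ ≤ 1 := by
  simpa using norm_expect_sum_le hρ hO (A := fun _ : Unit => 1) (B := fun _ => 1) zero_le_one
    (by simp) (by simp)

theorem opNorm_mul_le_one {A B : Matrix n n ℂ} (hA : opNorm A ≤ 1) (hB : opNorm B ≤ 1) :
    opNorm (A * B) ≤ 1 := by
  have : opNorm (A * B) ≤ opNorm A * opNorm B := by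
    open scoped Matrix.Norms.L2Operator in
    exact Matrix.l2_opNorm_mul A B
  exact this.trans (mul_le_one₀ hA (norm_nonneg _) hB)

theorem norm_corr_le {ρ A B : Matrix n n ℂ} (hρ : IsState ρ) (hA : opNorm A ≤ 1)
    (hB : opNorm B ≤ 1) : ‖corr ρ A B‖ ≤ 2 := by
  have e : expect ρ (A * B + B * A) = expect ρ (A * B) + expect ρ (B * A) := by
    simp [expect, Matrix.mul_add]
  have h1 := norm_expect_le hρ (opNorm_mul_le_one hA hB)
  have h2 := norm_expect_le hρ (opNorm_mul_le_one hB hA)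
  have h3 := norm_expect_le hρ hA
  have h4 := norm_expect_le hρ hB
  rw [corr, e]
  refine (norm_sub_le _ _).trans ?_
  rw [norm_mul, norm_div]
  have h5 := norm_add_le (expect ρ (A * B)) (expect ρ (B * A))
  have h6 : ‖expect ρ A‖ * ‖expect ρ B‖ ≤ 1 := mul_le_one₀ h3 (norm_nonneg _) h4
  simp only [Complex.norm_ofNat]
  linarith

end MatrixTools

/-! ### Tensor-stable norm bounds for qubit maps: Kraus forms and the diamond norm. -/

section

variable {Λ : Type*} [Fintype Λ] [DecidableEq Λ]

/-- `Ψ(X) = ∑ A_k X B_k†` with `∑ A_k† A_k = ∑ B_k† B_k = c`. This bounds the completely bounded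
norm of `Ψ` by `c`, in a form that is multiplicative under tensor products. -/
def Factors (Ψ : QubitMap) (c : ℝ) : Prop :=
  ∃ (m : ℕ) (A B : Fin m → Matrix (Fin 2) (Fin 2) ℂ),
    (∀ X, Ψ X = ∑ k, A k * X * (B k).conjTranspose) ∧
    ∑ k, (A k).conjTranspose * A k = (c : ℂ) • 1 ∧
    ∑ k, (B k).conjTranspose * B k = (c : ℂ) • 1

theorem factors_of_fintype {ι : Type*} [Fintype ι] {Ψ : QubitMap} {c : ℝ}
    (A B : ι → Matrix (Fin 2) (Fin 2) ℂ)
    (h : ∀ X, Ψ X = ∑ k, A k * X * (B k).conjTranspose)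
    (hA : ∑ k, (A k).conjTranspose * A k = (c : ℂ) • 1)
    (hB : ∑ k, (B k).conjTranspose * B k = (c : ℂ) • 1) : Factors Ψ c := by
  let e := (Fintype.equivFin ι).symm
  refine ⟨Fintype.card ι, A ∘ e, B ∘ e, fun X => ?_, ?_, ?_⟩
  · rw [h, ← e.sum_comp]; rfl
  · rw [← hA, ← e.sum_comp]; rfl
  · rw [← hB, ← e.sum_comp]; rfl

/-- A Kraus decomposition of a trace-preserving map. -/
def IsKraus (Φ : QubitMap) : Prop :=
  ∃ (m : ℕ) (A : Fin m → Matrix (Fin 2) (Fin 2) ℂ),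
    (∀ X, Φ X = ∑ k, A k * X * (A k).conjTranspose) ∧
    ∑ k, (A k).conjTranspose * A k = 1

theorem IsKraus.factors {Φ : QubitMap} (h : IsKraus Φ) : Factors Φ 1 := by
  obtain ⟨m, A, h1, h2⟩ := h
  exact ⟨m, A, A, h1, by simpa using h2, by simpa using h2⟩

theorem sum_conjTranspose_kron_mul {m : Λ → ℕ} {A : ∀ i, Fin (m i) → Matrix (Fin 2) (Fin 2) ℂ}
    {c : Λ → ℝ} (h : ∀ i, ∑ k, (A i k).conjTranspose * A i k = (c i : ℂ) • 1) :
    ∑ k : (∀ i, Fin (m i)), (kron fun i => A i (k i)).conjTranspose * kron (fun i => A i (k i)) =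
      ((∏ i, c i : ℝ) : ℂ) • 1 := by
  simp_rw [kron_conjTranspose, kron_mul]
  rw [sum_kron (fun i k => (A i k).conjTranspose * A i k)]
  simp_rw [h]
  rw [kron_smul_one]
  push_cast; rfl

theorem norm_expect_tensorMap_le {Ψ : Λ → QubitMap} {c : Λ → ℝ} (hc : ∀ i, 0 ≤ c i)
    (h : ∀ i, Factors (Ψ i) (c i)) {ρ O : Matrix (Λ → Fin 2) (Λ → Fin 2) ℂ} (hρ : IsState ρ)
    (hO : opNorm O ≤ 1) : ‖expect (tensorMap Ψ ρ) O‖ ≤ ∏ i, c i := by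
  choose m A B h1 h2 h3 using h
  rw [tensorMap_eq_sum h1]
  exact norm_expect_sum_le hρ hO (Finset.prod_nonneg fun i _ => hc i)
    (sum_conjTranspose_kron_mul h2) (sum_conjTranspose_kron_mul h3)

theorem IsKraus.exists_tensorPower_eq {Φ : QubitMap} (h : IsKraus Φ) :
    ∃ (ι : Type) (_ : Fintype ι) (A : ι → Matrix (Λ → Fin 2) (Λ → Fin 2) ℂ),
      (∀ ρ, tensorPower Φ ρ = ∑ k, A k * ρ * (A k).conjTranspose) ∧
      ∑ k, (A k).conjTranspose * A k = 1 := by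
  obtain ⟨m, A, h1, h2⟩ := h
  let e := (Fintype.equivFin (Λ → Fin m)).symm
  refine ⟨Fin (Fintype.card (Λ → Fin m)), inferInstance, fun k => kron fun i => A (e k i),
    fun ρ => ?_, ?_⟩
  · rw [tensorPower_eq_tensorMap, tensorMap_eq_sum (n := fun _ => m) (A := fun _ => A)
      (B := fun _ => A) (fun _ => h1)]
    exact (e.sum_comp _).symm
  · have := sum_conjTranspose_kron_mul (Λ := Λ) (m := fun _ => m) (A := fun _ => A)
      (c := fun _ => 1) (fun _ => by simpa using h2)
    rw [← e.sum_comp] at this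
    simpa using this

theorem IsKraus.isState_tensorPower {Φ : QubitMap} (h : IsKraus Φ)
    {ρ : Matrix (Λ → Fin 2) (Λ → Fin 2) ℂ} (hρ : IsState ρ) : IsState (tensorPower Φ ρ) := by
  obtain ⟨ι, _, A, h1, h2⟩ := h.exists_tensorPower_eq (Λ := Λ)
  rw [h1]
  refine ⟨Matrix.posSemidef_sum _ fun k _ => hρ.1.mul_mul_conjTranspose_same _, ?_⟩
  rw [Matrix.trace_sum]
  simp_rw [Matrix.trace_mul_comm (A _ * ρ), ← Matrix.mul_assoc]
  rw [← Matrix.trace_sum, ← Matrix.sum_mul, h2, Matrix.one_mul, hρ.2]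

theorem qubitMap_apply_eq_sum (Φ : QubitMap) (X : Matrix (Fin 2) (Fin 2) ℂ) (x y : Fin 2) :
    Φ X x y = ∑ u, ∑ v, X u v * Φ (Matrix.single u v 1) x y := by
  conv_lhs => rw [Matrix.matrix_eq_sum_single X]
  simp only [map_sum, Matrix.sum_apply]
  refine Finset.sum_congr rfl fun u _ => Finset.sum_congr rfl fun v _ => ?_
  rw [show Matrix.single u v (X u v) = X u v • Matrix.single u v (1 : ℂ) by simp, map_smul]
  rfl

theorem sandwich_apply (A B X : Matrix (Fin 2) (Fin 2) ℂ) (x y : Fin 2) :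
    (A * X * B.conjTranspose) x y = ∑ u, ∑ v, X u v * (A x u * star (B y v)) := by
  simp only [Matrix.mul_apply, Matrix.conjTranspose_apply, Finset.sum_mul]
  rw [Finset.sum_comm]
  refine Finset.sum_congr rfl fun u _ => Finset.sum_congr rfl fun v _ => by ring

/-- Choi's argument: a two-dimensional ancilla and the unnormalised maximally entangled vector `w`
give a positive Choi matrix, and the columns of its square root `T`, reshaped, are Kraus operators.
-/
theorem IsChannel.isKraus {Φ : QubitMap} (h : IsChannel Φ) : IsKraus Φ := by
  let w : Fin 2 × Fin 2 → ℂ := fun x => if x.1 = x.2 then 1 else 0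
  have hpos := h.1 2 _ (Matrix.posSemidef_vecMulVec_self_star w)
  obtain ⟨T, hT1, hT⟩ := exists_posSemidef_sqrt hpos
  have hent : ∀ x y u v, Φ (Matrix.single u v 1) x y = ∑ k, T (x, u) k * star (T (y, v) k) := by
    intro x y u v
    have h1 : (ampliate Φ 2 (Matrix.vecMulVec w (star w))) (x, u) (y, v) =
        Φ (Matrix.single u v 1) x y := by
      simp only [ampliate, Matrix.of_apply]
      refine congrArg (fun Z => Φ Z x y) (Matrix.ext fun a b => ?_)
      simp only [w, Matrix.vecMulVec_apply, Matrix.single_apply, Matrix.of_apply, Pi.star_apply,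
        ite_and, eq_comm (a := u), eq_comm (a := v)]
      split_ifs <;> simp
    rw [← h1, ← hT, Matrix.mul_apply]
    refine Finset.sum_congr rfl fun k _ => ?_
    rw [← Matrix.conjTranspose_apply T, hT1.1.eq]
  let e := (Fintype.equivFin (Fin 2 × Fin 2)).symm
  refine ⟨_, fun k => Matrix.of fun x u => T (x, u) (e k), fun X => ?_, ?_⟩
  · ext x y
    rw [qubitMap_apply_eq_sum, Matrix.sum_apply]
    simp_rw [sandwich_apply, hent, Finset.mul_sum, Matrix.of_apply]
    rw [e.sum_comp fun k => ∑ u, ∑ v, X u v * (T (x, u) k * star (T (y, v) k))]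
    conv_rhs => rw [Finset.sum_comm]
    refine Finset.sum_congr rfl fun u _ => ?_
    rw [Finset.sum_comm]
  · ext v u
    rw [Matrix.sum_apply]
    simp only [Matrix.mul_apply, Matrix.conjTranspose_apply, Matrix.of_apply]
    rw [e.sum_comp fun k => ∑ x, star (T (x, v) k) * T (x, u) k, Finset.sum_comm]
    have := h.2 (Matrix.single u v 1)
    simp only [Matrix.trace, Matrix.diag_apply, hent] at this
    simp_rw [mul_comm (star _)]
    rw [this]
    simp [Matrix.single_apply, Matrix.one_apply, ite_and]

section TraceNorm

variable {n : Type*} [Fintype n] [DecidableEq n]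

/-- An entry is at most the Hilbert-Schmidt norm, which is the ℓ² norm of the singular values and
hence at most their ℓ¹ norm. -/
theorem norm_apply_le_traceNorm (X : Matrix n n ℂ) (i j : n) : ‖X i j‖ ≤ traceNorm X := by
  have hX := Matrix.isHermitian_conjTranspose_mul_self X
  have hnn : ∀ i, 0 ≤ hX.eigenvalues i := fun i =>
    (Matrix.posSemidef_conjTranspose_mul_self X).eigenvalues_nonneg i
  have h1 : frobSq X = ∑ i, hX.eigenvalues i := by
    have := trace_conjTranspose_mul_self X
    rw [hX.trace_eq_sum_eigenvalues] at this
    apply Complex.ofReal_injective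
    rw [← this, Complex.ofReal_sum]
    rfl
  have h2 : ‖X i j‖ ^ 2 ≤ frobSq X :=
    (Finset.single_le_sum (f := fun j => ‖X i j‖ ^ 2) (fun _ _ => sq_nonneg _)
      (Finset.mem_univ j)).trans
      (Finset.single_le_sum (f := fun i => ∑ j, ‖X i j‖ ^ 2)
        (fun _ _ => Finset.sum_nonneg fun _ _ => sq_nonneg _) (Finset.mem_univ i))
  have h3 : ∑ i, hX.eigenvalues i ≤ (∑ i, √(hX.eigenvalues i)) ^ 2 := by
    rw [sq, Finset.sum_mul]
    refine Finset.sum_le_sum fun k _ => ?_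
    calc hX.eigenvalues k = √(hX.eigenvalues k) * √(hX.eigenvalues k) :=
          (Real.mul_self_sqrt (hnn k)).symm
      _ ≤ _ := mul_le_mul_of_nonneg_left (Finset.single_le_sum
          (f := fun k => √(hX.eigenvalues k)) (fun _ _ => Real.sqrt_nonneg _)
          (Finset.mem_univ k)) (Real.sqrt_nonneg _)
  exact le_of_sq_le_sq ((h2.trans h1.le).trans h3) (Finset.sum_nonneg fun _ _ => Real.sqrt_nonneg _)

/-- X†X is a projection of trace 1, so its eigenvalues equal their own square roots and sum to 1. -/
theorem traceNorm_single (i j : n) : traceNorm (Matrix.single i j (1 : ℂ)) = 1 := by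
  have hX := Matrix.isHermitian_conjTranspose_mul_self (Matrix.single i j (1 : ℂ))
  have hP : (Matrix.single i j (1 : ℂ)).conjTranspose * Matrix.single i j 1 =
      Matrix.single j j 1 := by simp
  have hid : ∀ k, hX.eigenvalues k * hX.eigenvalues k = hX.eigenvalues k := by
    intro k
    have h1 := hX.mulVec_eigenvectorBasis k
    have h2 : (Matrix.single j j (1 : ℂ)).mulVec ((Matrix.single j j (1 : ℂ)).mulVec
        (hX.eigenvectorBasis k).ofLp) = (Matrix.single j j (1 : ℂ)).mulVec
        (hX.eigenvectorBasis k).ofLp := by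
      rw [Matrix.mulVec_mulVec]; simp
    rw [← hP, h1, Matrix.mulVec_smul, h1, smul_smul] at h2
    have h3 : (hX.eigenvectorBasis k).ofLp ≠ 0 := by
      intro h
      apply hX.eigenvectorBasis.orthonormal.ne_zero k
      ext x; rw [h]; rfl
    exact smul_left_injective ℝ h3 h2
  have hs : ∀ k, √(hX.eigenvalues k) = hX.eigenvalues k := by
    intro k
    have h0 : 0 ≤ hX.eigenvalues k :=
      (Matrix.posSemidef_conjTranspose_mul_self (Matrix.single i j (1 : ℂ))).eigenvalues_nonneg k
    rw [Real.sqrt_eq_iff_mul_self_eq h0 h0]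
    exact (hid k).symm
  have ht := hX.trace_eq_sum_eigenvalues
  have h1 : ((Matrix.single i j (1 : ℂ)).conjTranspose * Matrix.single i j 1).trace = 1 := by
    rw [hP]; simp
  rw [h1] at ht
  simp only [traceNorm, hs]
  apply Complex.ofReal_injective
  rw [Complex.ofReal_sum, Complex.ofReal_one]
  exact ht.symm

end TraceNorm

/-- A one-dimensional ancilla and matrix units as test operators suffice. -/
theorem norm_apply_single_le_of_diamondNorm_le {Φ : QubitMap} {ε : ℝ} (hε : 0 ≤ ε)
    (h : diamondNorm Φ ≤ ENNReal.ofReal ε) (u v x y : Fin 2) :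
    ‖Φ (Matrix.single u v 1) x y‖ ≤ ε := by
  have h1 : ENNReal.ofReal (traceNorm (ampliate Φ 1 (Matrix.single (u, 0) (v, 0) 1))) ≤
      ENNReal.ofReal ε := by
    refine le_trans ?_ h
    exact le_iSup_of_le 1 (le_iSup_of_le _ (le_iSup_of_le (traceNorm_single _ _).le le_rfl))
  rw [ENNReal.ofReal_le_ofReal_iff hε] at h1
  refine le_trans (le_of_eq ?_) ((norm_apply_le_traceNorm _ (x, 0) (y, 0)).trans h1)
  simp only [ampliate, Matrix.of_apply]
  refine congrArg (fun Z => ‖Φ Z x y‖) (Matrix.ext fun a b => ?_)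
  simp [Matrix.single_apply, Prod.ext_iff]

/-- Decompose Φ into its 16 matrix coefficients δ; each contributes X ↦ δ E_{xu} X E_{yv}†, split as
δ/√ε on the left and √ε on the right. Every diagonal unit then receives weight ε from 8 index
choices, whence `8 * ε`. -/
theorem factors_of_norm_apply_single_le {Φ : QubitMap} {ε : ℝ} (hε : 0 ≤ ε)
    (h : ∀ u v x y, ‖Φ (Matrix.single u v 1) x y‖ ≤ ε) : Factors Φ (8 * ε) := by
  rcases hε.eq_or_lt with rfl | hε
  · refine ⟨0, fun _ => 0, fun _ => 0, fun X => ?_, by simp, by simp⟩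
    ext x y
    rw [qubitMap_apply_eq_sum]
    simp [fun u v => norm_le_zero_iff.1 (h u v x y)]
  let δ : Fin 2 × Fin 2 × Fin 2 × Fin 2 → ℂ :=
    fun q => Φ (Matrix.single q.1 q.2.1 1) q.2.2.1 q.2.2.2
  have hδ : ∀ q, 0 ≤ ε - ‖δ q‖ ^ 2 / ε := by
    intro q
    rw [sub_nonneg, div_le_iff₀ hε, ← sq]
    exact pow_le_pow_left₀ (norm_nonneg _) (h _ _ _ _) 2
  have hs : (√ε : ℂ) * √ε = ε := by rw [← Complex.ofReal_mul, Real.mul_self_sqrt hε.le]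
  have hs0 : (√ε : ℂ) ≠ 0 := by exact_mod_cast (Real.sqrt_pos.2 hε).ne'
  -- The `false` branch pads the left family with operators paired with 0 on the right. They do not
  -- affect the map but make the left normalisation an equality.
  refine factors_of_fintype (ι := (Fin 2 × Fin 2 × Fin 2 × Fin 2) × Bool)
    (fun q => (if q.2 then δ q.1 / √ε else (√(ε - ‖δ q.1‖ ^ 2 / ε) : ℂ)) •
      Matrix.single q.1.2.2.1 q.1.1 1)
    (fun q => (if q.2 then (√ε : ℂ) else 0) • Matrix.single q.1.2.2.2 q.1.2.1 1)
    (fun X => ?_) ?_ ?_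
  · ext x y
    rw [qubitMap_apply_eq_sum, Matrix.sum_apply, Fintype.sum_prod_type]
    simp only [Fintype.sum_bool, if_true, Bool.false_eq_true, if_false, sandwich_apply,
      Fintype.sum_prod_type, Fin.sum_univ_two, Matrix.smul_apply, Matrix.single_apply]
    fin_cases x <;> fin_cases y <;> simp [δ] <;> field_simp
  · have : ∀ q : Fin 2 × Fin 2 × Fin 2 × Fin 2, (δ q / √ε) * star (δ q / √ε) +
        (√(ε - ‖δ q‖ ^ 2 / ε) : ℂ) * star (√(ε - ‖δ q‖ ^ 2 / ε) : ℂ) = ε := by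
      intro q
      have h1 : (√(ε - ‖δ q‖ ^ 2 / ε) : ℂ) * star (√(ε - ‖δ q‖ ^ 2 / ε) : ℂ) =
          ε - ‖δ q‖ ^ 2 / ε := by
        rw [Complex.star_def, Complex.conj_ofReal, ← Complex.ofReal_mul, Real.mul_self_sqrt (hδ q)]
        push_cast; rfl
      have h2 : (δ q / √ε) * star (δ q / √ε) = ‖δ q‖ ^ 2 / ε := by
        rw [Complex.star_def, map_div₀, Complex.conj_ofReal, div_mul_div_comm,
          hs, Complex.mul_conj']
      rw [h1, h2]; ring
    rw [Fintype.sum_prod_type]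
    simp only [Fintype.sum_bool, if_true, Bool.false_eq_true, if_false,
      Matrix.conjTranspose_smul, Matrix.conjTranspose_single, star_one, Matrix.smul_mul,
      Matrix.mul_smul, smul_smul, Matrix.single_mul_single_same, mul_one, ← add_smul, this]
    ext i j
    fin_cases i <;> fin_cases j <;>
      simp [Fintype.sum_prod_type, Fin.sum_univ_two]
  · rw [Fintype.sum_prod_type]
    simp only [Fintype.sum_bool, if_true, Bool.false_eq_true, if_false,
      Matrix.conjTranspose_smul, Matrix.conjTranspose_single, star_one, Matrix.smul_mul,
      Matrix.mul_smul, smul_smul, Matrix.single_mul_single_same, mul_one]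
    ext i j
    fin_cases i <;> fin_cases j <;>
      simp [Fintype.sum_prod_type, Fin.sum_univ_two, hs] <;> ring

end

/-! ### The symmetric logarithmic derivative, Cramér-Rao and Powers-Størmer. -/

section FisherInformation

variable {n : Type*} [Fintype n] [DecidableEq n]

theorem frobSq_mul_sqrt {L S : Matrix n n ℂ} (hL : L.IsHermitian) (hS : S.IsHermitian) :
    frobSq (L * S) = (expect (S * S) (L * L)).re := by
  have := trace_conjTranspose_mul_self (L * S)
  rw [Matrix.conjTranspose_mul, hL.eq, hS.eq, Matrix.trace_mul_comm] at this
  rw [expect, Matrix.trace_mul_comm]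
  rw [show L * S * (S * L) = L * (S * S * L) by simp only [Matrix.mul_assoc],
    Matrix.trace_mul_comm] at this
  rw [Matrix.trace_mul_comm, ← Matrix.mul_assoc, this, Complex.ofReal_re]

theorem trace_conjTranspose_re (X : Matrix n n ℂ) : X.conjTranspose.trace.re = X.trace.re := by
  rw [Matrix.trace_conjTranspose]; simp

/-- Tr(ρ'X) is the real part of the Hilbert-Schmidt product of LS and XS, where ρ = S²; apply
Cauchy-Schwarz. -/
theorem sq_trace_sld_mul_le {ρ L X : Matrix n n ℂ} (hρ : ρ.PosSemidef) (hL : L.IsHermitian)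
    (hX : X.IsHermitian) :
    ((((1 / 2 : ℂ) • (L * ρ + ρ * L)) * X).trace.re) ^ 2 ≤
      (expect ρ (L * L)).re * (expect ρ (X * X)).re := by
  obtain ⟨S, hS, rfl⟩ := exists_posSemidef_sqrt hρ
  rw [← frobSq_mul_sqrt hL hS.1, ← frobSq_mul_sqrt hX hS.1]
  have e1 : (S * S * L * X).trace = ((L * S).conjTranspose * (X * S)).trace := by
    rw [Matrix.conjTranspose_mul, hL.eq, hS.1.eq, Matrix.mul_assoc, Matrix.mul_assoc,
      Matrix.trace_mul_comm]
    simp only [Matrix.mul_assoc]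
  have e2 : (L * (S * S) * X).trace.re = (S * S * L * X).trace.re := by
    rw [← trace_conjTranspose_re (L * (S * S) * X)]
    simp only [Matrix.conjTranspose_mul, hL.eq, hS.1.eq, hX.eq]
    rw [Matrix.trace_mul_comm]
  have e3 : (((1 / 2 : ℂ) • (L * (S * S) + S * S * L)) * X).trace.re =
      (S * S * L * X).trace.re := by
    rw [Matrix.smul_mul, Matrix.trace_smul, Matrix.add_mul, Matrix.trace_add, smul_eq_mul,
      show (1 / 2 : ℂ) = ((1 / 2 : ℝ) : ℂ) by push_cast; rfl, Complex.re_ofReal_mul,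
      Complex.add_re, e2]
    ring
  rw [e3, e1]
  refine le_trans ?_ (norm_trace_sq_le _ _)
  rw [← sq_abs]
  exact pow_le_pow_left₀ (abs_nonneg _) (Complex.abs_re_le_norm _) 2

theorem IsState.expect_one {ρ : Matrix n n ℂ} (h : IsState ρ) : expect ρ 1 = 1 := by
  rw [expect, Matrix.mul_one, h.2]

theorem expect_conj {ρ A : Matrix n n ℂ} (hρ : ρ.IsHermitian) (hA : A.IsHermitian) :
    star (expect ρ A) = expect ρ A := by
  rw [expect, ← Matrix.trace_conjTranspose, Matrix.conjTranspose_mul, hρ.eq, hA.eq,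
    Matrix.trace_mul_comm]

theorem expect_eq_re {ρ A : Matrix n n ℂ} (hρ : ρ.IsHermitian) (hA : A.IsHermitian) :
    expect ρ A = ((expect ρ A).re : ℂ) :=
  (Complex.conj_eq_iff_re.1 (expect_conj hρ hA)).symm

theorem isHermitian_sub_smul_one {O : Matrix n n ℂ} (hO : O.IsHermitian) (m : ℝ) :
    (O - (m : ℂ) • (1 : Matrix n n ℂ)).IsHermitian := by
  refine hO.sub ?_
  rw [Matrix.IsHermitian, Matrix.conjTranspose_smul, Matrix.conjTranspose_one]
  simp

theorem variance_eq_expect_centered {ρ O : Matrix n n ℂ} (hρ : IsState ρ) (hO : O.IsHermitian) :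
    variance ρ O = (expect ρ ((O - ((expect ρ O).re : ℂ) • 1) *
      (O - ((expect ρ O).re : ℂ) • 1))).re := by
  have hmO : expect ρ O = ((expect ρ O).re : ℂ) := expect_eq_re hρ.1.1 hO
  set m : ℝ := (expect ρ O).re
  rw [variance, corr, hmO]
  have e1 : expect ρ (O * O + O * O) = 2 * expect ρ (O * O) := by
    simp [expect, Matrix.mul_add, two_mul]
  have e2 : expect ρ ((O - (m : ℂ) • 1) * (O - (m : ℂ) • 1)) =
      expect ρ (O * O) - 2 * m * expect ρ O + m * m * expect ρ 1 := by
    simp only [expect, Matrix.sub_mul, Matrix.mul_sub, Matrix.smul_mul, Matrix.mul_smul,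
      Matrix.one_mul, Matrix.mul_one, Matrix.trace_sub, Matrix.trace_smul, smul_eq_mul]
    ring
  rw [e1, e2, hmO, hρ.expect_one]
  congr 1; ring

/-- The quantum Cramér-Rao inequality. -/
theorem sq_trace_sld_mul_le_variance {ρ L O : Matrix n n ℂ} (hρ : IsState ρ) (hL : L.IsHermitian)
    (hO : O.IsHermitian) (h0 : ((1 / 2 : ℂ) • (L * ρ + ρ * L)).trace = 0) :
    ((((1 / 2 : ℂ) • (L * ρ + ρ * L)) * O).trace.re) ^ 2 ≤
      (expect ρ (L * L)).re * variance ρ O := by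
  -- The derivative has trace 0, so centring the observable leaves the left side unchanged and turns
  -- the second moment into the variance.
  have h := sq_trace_sld_mul_le hρ.1 hL (isHermitian_sub_smul_one hO (expect ρ O).re)
  rwa [Matrix.mul_sub, Matrix.trace_sub, Matrix.mul_smul, Matrix.mul_one, Matrix.trace_smul, h0,
    smul_zero, sub_zero, ← variance_eq_expect_centered hρ hO] at h

/-- Polarisation, testing on v + w and v + iw. -/
theorem dotProduct_mulVec_eq_zero_of_forall {D : Matrix n n ℂ} {P : Submodule ℂ (n → ℂ)}
    (h : ∀ v ∈ P, star v ⬝ᵥ D.mulVec v = 0) {v w : n → ℂ} (hv : v ∈ P) (hw : w ∈ P) :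
    star v ⬝ᵥ D.mulVec w = 0 := by
  have h1 := h _ (P.add_mem hv hw)
  have h2 := h _ (P.add_mem hv (P.smul_mem Complex.I hw))
  simp only [star_add, star_smul, Matrix.mulVec_add, Matrix.mulVec_smul, dotProduct_add,
    add_dotProduct, dotProduct_smul, smul_dotProduct, h _ hv, h _ hw, smul_eq_mul,
    Complex.star_def, Complex.conj_I] at h1 h2
  linear_combination (1 / 2 : ℂ) * h1 - (Complex.I / 2) * h2 +
    (1 / 2 : ℂ) * (star v ⬝ᵥ D.mulVec w) * Complex.I_mul_I -
    (1 / 2 : ℂ) * (star w ⬝ᵥ D.mulVec v) * Complex.I_mul_I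

theorem hasDerivAt_dotProduct_mulVec {ρ : ℝ → Matrix n n ℂ} {θ : ℝ} {D : Matrix n n ℂ}
    (hD : ∀ i j, HasDerivAt (fun t => ρ t i j) (D i j) θ) (v w : n → ℂ) :
    HasDerivAt (fun t => v ⬝ᵥ (ρ t).mulVec w) (v ⬝ᵥ D.mulVec w) θ := by
  simp only [dotProduct, Matrix.mulVec]
  refine HasDerivAt.fun_sum fun i _ => HasDerivAt.const_mul _ ?_
  exact HasDerivAt.fun_sum fun j _ => (hD i j).mul_const _

theorem isHermitian_of_hasDerivAt {ρ : ℝ → Matrix n n ℂ} {θ : ℝ} {D : Matrix n n ℂ}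
    (hρ : ∀ t, (ρ t).IsHermitian) (hD : ∀ i j, HasDerivAt (fun t => ρ t i j) (D i j) θ) :
    D.IsHermitian := by
  ext i j
  rw [Matrix.conjTranspose_apply]
  have h1 := (hD j i).star
  have h2 : (fun t => star (ρ t j i)) = fun t => ρ t i j := by
    ext t; exact (hρ t).apply i j
  rw [h2] at h1
  exact h1.unique (hD i j)

/-- In an eigenbasis of ρ_θ the equation reads D_jk = (μ_j + μ_k)L_jk/2, solvable unless D is
nonzero on the kernel of ρ_θ. For v in that kernel, ⟨v, ρ_t v⟩ ≥ 0 has a minimum at θ, so its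
derivative vanishes; polarisation kills the whole block. -/
theorem exists_sld {ρ : ℝ → Matrix n n ℂ} {θ : ℝ} {D : Matrix n n ℂ}
    (hρ : ∀ t, (ρ t).PosSemidef) (hD : ∀ i j, HasDerivAt (fun t => ρ t i j) (D i j) θ) :
    ∃ L : Matrix n n ℂ, L.IsHermitian ∧ D = (1 / 2 : ℂ) • (L * ρ θ + ρ θ * L) := by
  have hDH := isHermitian_of_hasDerivAt (fun t => (hρ t).1) hD
  obtain ⟨V, μ, hV1, hV2, hV, hμ⟩ := exists_diagonalization (hρ θ).1
  replace hμ := hμ (hρ θ)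
  have hker : ∀ v, (ρ θ).mulVec v = 0 → star v ⬝ᵥ D.mulVec v = 0 := by
    intro v hv
    have h1 := (hasDerivAt_dotProduct_mulVec hD (star v) v)
    have h2 : HasDerivAt (fun t => (star v ⬝ᵥ (ρ t).mulVec v).re) (star v ⬝ᵥ D.mulVec v).re θ := by
      have := Complex.reCLM.hasFDerivAt.comp_hasDerivAt θ h1
      exact this
    have h3 : IsLocalMin (fun t => (star v ⬝ᵥ (ρ t).mulVec v).re) θ := by
      refine Filter.Eventually.of_forall fun t => ?_
      simp only [hv, dotProduct_zero, Complex.zero_re]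
      exact (hρ t).re_dotProduct_nonneg v
    have h4 := h3.hasDerivAt_eq_zero h2
    have h5 : star (star v ⬝ᵥ D.mulVec v) = star v ⬝ᵥ D.mulVec v := by
      rw [← Matrix.star_dotProduct_star, star_star, Matrix.star_mulVec, hDH.eq, dotProduct_comm,
        Matrix.dotProduct_mulVec]
      exact dotProduct_comm _ _
    have h6 := Complex.conj_eq_iff_re.1 h5
    rw [← h6, h4, Complex.ofReal_zero]
  let D' := V.conjTranspose * D * V
  have hD'H : D'.IsHermitian := by
    simp only [D', Matrix.IsHermitian, Matrix.conjTranspose_mul, Matrix.conjTranspose_conjTranspose,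
      hDH.eq, Matrix.mul_assoc]
  have hD'0 : ∀ j k, μ j = 0 → μ k = 0 → D' j k = 0 := by
    intro j k hj hk
    have hcol : ∀ j, μ j = 0 → (ρ θ).mulVec (V.mulVec (Pi.single j 1)) = 0 := by
      intro j hj
      rw [hV, Matrix.mulVec_mulVec, Matrix.mul_assoc, hV1, Matrix.mul_one, ← Matrix.mulVec_mulVec,
        Matrix.diagonal_mulVec_single, hj]
      simp
    have := dotProduct_mulVec_eq_zero_of_forall (D := D) (P := LinearMap.ker (ρ θ).mulVecLin)
      (fun v hv => hker v hv) (v := V.mulVec (Pi.single j 1)) (w := V.mulVec (Pi.single k 1))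
      (hcol j hj) (hcol k hk)
    rw [Matrix.star_mulVec, ← Matrix.dotProduct_mulVec, Matrix.mulVec_mulVec,
      Matrix.mulVec_mulVec] at this
    simpa using this
  -- On the kernel block the denominator is 0, and division by zero sets the entry to 0.
  let L' : Matrix n n ℂ := Matrix.of fun j k => 2 * D' j k / (μ j + μ k)
  refine ⟨V * L' * V.conjTranspose, ?_, ?_⟩
  · have : L'.IsHermitian := by
      ext j k
      simp only [Matrix.conjTranspose_apply, L', Matrix.of_apply]
      rw [← hD'H.apply j k, add_comm]
      simp
    simp only [Matrix.IsHermitian, Matrix.conjTranspose_mul, Matrix.conjTranspose_conjTranspose,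
      this.eq, Matrix.mul_assoc]
  · have key : D' = (1 / 2 : ℂ) • (L' * Matrix.diagonal (fun i => (μ i : ℂ)) +
        Matrix.diagonal (fun i => (μ i : ℂ)) * L') := by
      ext j k
      simp only [Matrix.smul_apply, Matrix.add_apply, Matrix.mul_diagonal, Matrix.diagonal_mul,
        L', Matrix.of_apply, smul_eq_mul]
      by_cases h : μ j + μ k = 0
      · have hj : μ j = 0 := by linarith [hμ j, hμ k]
        have hk : μ k = 0 := by linarith [hμ j, hμ k]
        simp [hj, hk, hD'0 j k hj hk]
      · have : (μ j + μ k : ℂ) ≠ 0 := by exact_mod_cast h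
        field_simp
        ring
    have e : D = V * D' * V.conjTranspose := by
      simp only [D', Matrix.mul_assoc, hV2, Matrix.mul_one]
      rw [← Matrix.mul_assoc V, hV2, Matrix.one_mul]
    rw [e, key, hV]
    simp only [Matrix.mul_smul, Matrix.smul_mul, Matrix.mul_add, Matrix.add_mul, Matrix.mul_assoc]
    congr 2
    · rw [← Matrix.mul_assoc V.conjTranspose V, hV1, Matrix.one_mul]
    · rw [← Matrix.mul_assoc V.conjTranspose V, hV1, Matrix.one_mul]

/-- The **Powers-Størmer inequality** with an explicit Hermitian contraction. -/
theorem exists_frobSq_sub_le {A B : Matrix n n ℂ} (hA : A.PosSemidef) (hB : B.PosSemidef) :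
    ∃ E : Matrix n n ℂ, (1 - E).PosSemidef ∧ (1 + E).PosSemidef ∧
      frobSq (A - B) ≤ (E * (A * A - B * B)).trace.re := by
  obtain ⟨V, μ, hV1, hV2, hV, -⟩ := exists_diagonalization (hA.1.sub hB.1)
  -- `E` is the sign of A - B, with the sign of 0 taken to be 1.
  let s : n → ℝ := fun k => if 0 ≤ μ k then 1 else -1
  have hs : ∀ k, s k * μ k = |μ k| := by
    intro k
    by_cases h : 0 ≤ μ k
    · simp [s, h, abs_of_nonneg h]
    · simp [s, h, abs_of_neg (not_le.1 h)]
  have hs1 : ∀ k, 0 ≤ 1 - s k ∧ 0 ≤ 1 + s k := by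
    intro k
    by_cases h : 0 ≤ μ k <;> simp [s, h]
  let A' := V.conjTranspose * A * V
  let B' := V.conjTranspose * B * V
  have hA' : A'.PosSemidef := hA.conjTranspose_mul_mul_same V
  have hB' : B'.PosSemidef := hB.conjTranspose_mul_mul_same V
  have hsub : A' - B' = Matrix.diagonal fun k => (μ k : ℂ) := by
    simp only [A', B']
    rw [← Matrix.sub_mul, ← Matrix.mul_sub, hV]
    simp only [← Matrix.mul_assoc, hV1, Matrix.one_mul]
    rw [Matrix.mul_assoc, hV1, Matrix.mul_one]
  have hone : ∀ f : n → ℝ, V * Matrix.diagonal (fun k => ((1 + f k : ℝ) : ℂ)) * V.conjTranspose =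
      1 + V * Matrix.diagonal (fun k => (f k : ℂ)) * V.conjTranspose := by
    intro f
    have : Matrix.diagonal (fun k => ((1 + f k : ℝ) : ℂ)) =
        1 + Matrix.diagonal (fun k => (f k : ℂ)) := by
      rw [← Matrix.diagonal_one, Matrix.diagonal_add]; push_cast; rfl
    rw [this, Matrix.mul_add, Matrix.add_mul, Matrix.mul_one, hV2]
  refine ⟨V * Matrix.diagonal (fun k => (s k : ℂ)) * V.conjTranspose, ?_, ?_, ?_⟩
  · have := (posSemidef_diagonal_ofReal fun k => (hs1 k).1).mul_mul_conjTranspose_same V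
    convert this using 1
    have h2 := hone fun k => - s k
    rw [show (fun k => ((1 - s k : ℝ) : ℂ)) = fun k => ((1 + - s k : ℝ) : ℂ) by
      ext k; rw [sub_eq_add_neg], h2, sub_eq_add_neg, ← Matrix.neg_mul, ← Matrix.mul_neg,
      Matrix.diagonal_neg]
    push_cast; rfl
  · rw [← hone]
    exact (posSemidef_diagonal_ofReal fun k => (hs1 k).2).mul_mul_conjTranspose_same V
  · have e1 : frobSq (A - B) = ∑ k, μ k ^ 2 := by
      have h1 := trace_conjTranspose_mul_self (A - B)
      rw [(hA.1.sub hB.1).eq, hV] at h1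
      rw [show V * Matrix.diagonal (fun k => (μ k : ℂ)) * V.conjTranspose *
          (V * Matrix.diagonal (fun k => (μ k : ℂ)) * V.conjTranspose) =
          V * (Matrix.diagonal (fun k => (μ k : ℂ)) * Matrix.diagonal (fun k => (μ k : ℂ)) *
            V.conjTranspose) by
        simp only [Matrix.mul_assoc]
        rw [← Matrix.mul_assoc V.conjTranspose V, hV1, Matrix.one_mul], Matrix.trace_mul_comm,
        Matrix.mul_assoc, hV1, Matrix.mul_one, Matrix.diagonal_mul_diagonal,
        Matrix.trace_diagonal, ← hV] at h1
      apply Complex.ofReal_injective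
      rw [← h1]; push_cast
      exact Finset.sum_congr rfl fun k _ => by ring
    have e2 : (V * Matrix.diagonal (fun k => (s k : ℂ)) * V.conjTranspose *
        (A * A - B * B)).trace = ∑ k, ((s k * μ k : ℝ) : ℂ) * (A' k k + B' k k) := by
      have h1 : V.conjTranspose * (A * A - B * B) * V = A' * A' - B' * B' := by
        simp only [A', B', Matrix.mul_sub, Matrix.sub_mul]
        congr 1
        · simp only [Matrix.mul_assoc]
          rw [← Matrix.mul_assoc V V.conjTranspose, hV2, Matrix.one_mul]
        · simp only [Matrix.mul_assoc]
          rw [← Matrix.mul_assoc V V.conjTranspose, hV2, Matrix.one_mul]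
      -- Symmetrising A² - B² puts the diagonal factor A' - B' beside A' + B', so only the diagonal
      -- entries of the latter enter the trace.
      have h2 : A' * A' - B' * B' = (1 / 2 : ℂ) • ((A' - B') * (A' + B') + (A' + B') * (A' - B')) := by
        rw [show (A' - B') * (A' + B') + (A' + B') * (A' - B') =
          (2 : ℂ) • (A' * A' - B' * B') by rw [two_smul]; noncomm_ring, smul_smul]
        norm_num
      rw [Matrix.mul_assoc, Matrix.mul_assoc, Matrix.trace_mul_comm, Matrix.mul_assoc, h1, h2, hsub,
        Matrix.trace]
      refine Finset.sum_congr rfl fun k _ => ?_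
      simp only [Matrix.diag_apply, Matrix.diagonal_mul, Matrix.smul_apply, Matrix.add_apply,
        Matrix.mul_diagonal, smul_eq_mul]
      push_cast; ring
    rw [e1, e2, Complex.re_sum]
    refine Finset.sum_le_sum fun k _ => ?_
    rw [Complex.re_ofReal_mul, hs, Complex.add_re]
    have h1 : 0 ≤ (A' k k).re := (Complex.le_def.1 hA'.diag_nonneg).1
    have h2 : 0 ≤ (B' k k).re := (Complex.le_def.1 hB'.diag_nonneg).1
    have h3 : (A' k k).re - (B' k k).re = μ k := by
      have := congrFun (congrFun hsub k) k
      rw [Matrix.sub_apply, Matrix.diagonal_apply_eq] at this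
      simpa using congrArg Complex.re this
    -- Diagonal entries of positive matrices are nonnegative, so |A'_kk - B'_kk| ≤ A'_kk + B'_kk.
    rw [← sq_abs, sq]
    refine mul_le_mul_of_nonneg_left ?_ (abs_nonneg _)
    rw [← h3, abs_le]; constructor <;> linarith

end FisherInformation

/-! ### From Fisher information to an observable; Robertson's relation. -/

section CommutatorBound

variable {n : Type*} [Fintype n] [DecidableEq n]

/-- The matrix `-i [H, X]` for the diagonal matrix `H` with entries `h`. -/
def diagComm (h : n → ℝ) (X : Matrix n n ℂ) : Matrix n n ℂ :=
  Matrix.of fun x y => -Complex.I * (h x - h y) * X x y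

theorem diagComm_mul (h : n → ℝ) (X Y : Matrix n n ℂ) :
    diagComm h (X * Y) = X * diagComm h Y + diagComm h X * Y := by
  ext x y
  simp only [diagComm, Matrix.of_apply, Matrix.mul_apply, Matrix.add_apply, Finset.mul_sum,
    ← Finset.sum_add_distrib]
  exact Finset.sum_congr rfl fun z _ => by ring

theorem isHermitian_diagComm (h : n → ℝ) {X : Matrix n n ℂ} (hX : X.IsHermitian) :
    (diagComm h X).IsHermitian := by
  ext x y
  simp only [diagComm, Matrix.conjTranspose_apply, Matrix.of_apply]
  rw [← hX.apply x y]
  simp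
  ring

/-- The quantum Fisher information of a unitary family is at most four times the skew
information. -/
theorem fisher_le_frobSq_diagComm {S L : Matrix n n ℂ} (h : n → ℝ) (hS : S.IsHermitian)
    (hL : L.IsHermitian)
    (hD : diagComm h (S * S) = (1 / 2 : ℂ) • (L * (S * S) + S * S * L)) :
    (expect (S * S) (L * L)).re ≤ 4 * frobSq (diagComm h S) := by
  set T := diagComm h S
  have hT : T.IsHermitian := isHermitian_diagComm h hS
  have e1 : ((1 / 2 : ℂ) • (L * (S * S) + S * S * L) * L).trace = expect (S * S) (L * L) := by
    rw [Matrix.smul_mul, Matrix.trace_smul, Matrix.add_mul, Matrix.trace_add, Matrix.mul_assoc,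
      Matrix.trace_mul_comm L, expect, Matrix.mul_assoc, smul_eq_mul]
    ring
  have e2 : ((S * T + T * S) * L).trace.re = 2 * ((L * S).conjTranspose * T).trace.re := by
    rw [Matrix.add_mul, Matrix.trace_add, Complex.add_re, ← trace_conjTranspose_re (S * T * L),
      Matrix.conjTranspose_mul, Matrix.conjTranspose_mul, hL.eq, hS.eq, hT.eq,
      Matrix.conjTranspose_mul, hL.eq, hS.eq, Matrix.mul_assoc T S L, Matrix.trace_mul_comm T,
      Matrix.trace_mul_comm L, Matrix.mul_assoc T S L, Matrix.trace_mul_comm T]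
    ring
  have e3 : (expect (S * S) (L * L)).re = 2 * ((L * S).conjTranspose * T).trace.re := by
    rw [← e1, ← hD, diagComm_mul, e2]
  have h1 := norm_trace_sq_le (L * S) T
  rw [frobSq_mul_sqrt hL hS] at h1
  set F := (expect (S * S) (L * L)).re
  -- By the Leibniz rule -i[H, S²] = ST + TS, so F = 2 Re⟨LS, T⟩, and ‖LS‖² is F itself.
  have h2 : F ^ 2 ≤ 4 * (F * frobSq T) := by
    have h3 : |((L * S).conjTranspose * T).trace.re| ^ 2 ≤ F * frobSq T :=
      (pow_le_pow_left₀ (abs_nonneg _) (Complex.abs_re_le_norm _) 2).trans h1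
    rw [sq_abs] at h3
    rw [e3, mul_pow, ← e3]
    linarith
  by_contra! hlt
  have := frobSq_nonneg T
  nlinarith

/-- A Hermitian contraction whose expectation changes at the speed `F / (8 m)` under the unitary
evolution with a generator of norm at most `m`. -/
theorem exists_observable_of_fisher {σ L : Matrix n n ℂ} (hσ : σ.PosSemidef) {h : n → ℝ} {m : ℝ}
    (hm : 0 < m) (hh : ∀ x, |h x| ≤ m) (hL : L.IsHermitian)
    (hD : diagComm h σ = (1 / 2 : ℂ) • (L * σ + σ * L)) :
    ∃ O : Matrix n n ℂ, (1 - O).PosSemidef ∧ (1 + O).PosSemidef ∧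
      (expect σ (L * L)).re / (8 * m) ≤ (expect (diagComm h σ) O).re := by
  obtain ⟨S, hS, rfl⟩ := exists_posSemidef_sqrt hσ
  have hF := fisher_le_frobSq_diagComm h hS.1 hL hD
  -- `r` is the resolvent of h/m and `u` its Cayley transform (1 + ih/m)/(1 - ih/m), a phase.
  let r : n → ℂ := fun x => (1 - Complex.I * (h x / m))⁻¹
  let u : n → ℂ := fun x => r x / star (r x)
  have hden : ∀ x, (1 - Complex.I * (h x / m) : ℂ) ≠ 0 := by
    intro x hx
    have := congrArg Complex.re hx
    simp [Complex.mul_re] at this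
  have hden' : ∀ x, (1 + Complex.I * (h x / m) : ℂ) ≠ 0 := by
    intro x hx
    have := congrArg Complex.re hx
    simp [Complex.mul_re] at this
  have hrs : ∀ x, star (r x) = (1 + Complex.I * (h x / m))⁻¹ := by
    intro x
    simp [r]
  have hr2 : ∀ x, star (r x) * r x = (((1 + (h x / m) ^ 2)⁻¹ : ℝ) : ℂ) := by
    intro x
    rw [hrs]
    simp only [r]
    rw [← mul_inv]
    push_cast
    congr 1
    linear_combination (-(h x / m : ℂ) ^ 2) * Complex.I_sq
  have hu : ∀ x y, 1 - u x * star (u y) =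
      2 / m * (r x * (-Complex.I * (h x - h y)) * star (r y)) := by
    intro x y
    have hm' : (m : ℂ) ≠ 0 := by exact_mod_cast hm.ne'
    have h1 := hden x
    have h2 := hden y
    have h3 := hden' x
    have h4 := hden' y
    have h5 : 2 / (m : ℂ) * (-Complex.I * (h x - h y)) =
        2 * (Complex.I * (h y / m) - Complex.I * (h x / m)) := by
      field_simp
      ring
    have h6 : star (star (r y)) = r y := star_star _
    rw [show 2 / (m : ℂ) * (r x * (-Complex.I * (h x - h y)) * star (r y)) =
      2 / (m : ℂ) * (-Complex.I * (h x - h y)) * r x * star (r y) by ring, h5]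
    rw [show star (u y) = star (r y) / r y by
      rw [show u y = r y / star (r y) from rfl, star_div₀, h6]]
    simp only [u, hrs]
    simp only [r]
    generalize Complex.I * (h x / m : ℂ) = a at *
    generalize Complex.I * (h y / m : ℂ) = b at *
    field_simp
    ring
  have huu : ∀ x, u x * star (u x) = 1 := by
    intro x
    have := hu x x
    rw [sub_self, mul_zero, mul_zero, zero_mul, mul_zero, sub_eq_zero] at this
    exact this.symm
  let U := Matrix.diagonal u
  let R := Matrix.diagonal r
  have hUU : U.conjTranspose * U = 1 := by
    simp only [U, Matrix.diagonal_conjTranspose, Matrix.diagonal_mul_diagonal]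
    rw [← Matrix.diagonal_one]
    congr 1; ext x
    rw [mul_comm]; exact huu x
  have hB : (U * S * U.conjTranspose).PosSemidef := hS.mul_mul_conjTranspose_same U
  obtain ⟨E, hE1, hE2, hE⟩ := exists_frobSq_sub_le hS hB
  have hBB : U * S * U.conjTranspose * (U * S * U.conjTranspose) =
      U * (S * S) * U.conjTranspose := by
    simp only [Matrix.mul_assoc]
    rw [← Matrix.mul_assoc U.conjTranspose U, hUU, Matrix.one_mul]
  have hconj : ∀ (f : n → ℂ) (X : Matrix n n ℂ) (x y : n),
      (Matrix.diagonal f * X * (Matrix.diagonal f).conjTranspose) x y =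
        f x * X x y * star (f y) := by
    intro f X x y
    rw [Matrix.diagonal_conjTranspose, Matrix.mul_diagonal, Matrix.diagonal_mul]
    rfl
  -- An exact identity, not an expansion in a small angle: the finite rotation by U produces the
  -- commutator itself.
  have hdiff : ∀ X : Matrix n n ℂ, X - U * X * U.conjTranspose =
      (2 / m : ℂ) • (R * diagComm h X * R.conjTranspose) := by
    intro X
    ext x y
    rw [Matrix.sub_apply, Matrix.smul_apply, hconj, hconj, diagComm, Matrix.of_apply, smul_eq_mul]
    linear_combination (X x y) * hu x y
  -- R is a contraction, hence 1 ∓ R†ER = (1 - R†R) + R†(1 ∓ E)R is positive.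
  have hRR : (1 - R.conjTranspose * R).PosSemidef := by
    have h1 : 1 - R.conjTranspose * R =
        Matrix.diagonal fun x => ((1 - (1 + (h x / m) ^ 2)⁻¹ : ℝ) : ℂ) := by
      simp only [R, Matrix.diagonal_conjTranspose, Matrix.diagonal_mul_diagonal]
      rw [← Matrix.diagonal_one, Matrix.diagonal_sub]
      congr 1; ext x
      rw [Complex.ofReal_sub, ← hr2 x, Complex.ofReal_one]
      rfl
    rw [h1]
    refine posSemidef_diagonal_ofReal fun x => sub_nonneg.2 (inv_le_one_of_one_le₀ ?_)
    linarith [sq_nonneg (h x / m)]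
  -- Here |h| ≤ m enters: the weights R cost at most a factor 1/4 in the squared norm.
  have hr : ∀ x, 1 / 2 ≤ ‖r x‖ ^ 2 := by
    intro x
    have h1 : ((‖r x‖ ^ 2 : ℝ) : ℂ) = (((1 + (h x / m) ^ 2)⁻¹ : ℝ) : ℂ) := by
      rw [← hr2 x, Complex.star_def, Complex.conj_mul']; push_cast; rfl
    rw [Complex.ofReal_injective h1, one_div]
    have h2 : (h x / m) ^ 2 ≤ 1 := by
      rw [← sq_abs, abs_div, abs_of_pos hm]
      exact pow_le_one₀ (by positivity) ((div_le_one hm).2 (hh x))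
    exact inv_anti₀ (by positivity) (by linarith)
  refine ⟨R.conjTranspose * E * R, ?_, ?_, ?_⟩
  · convert hRR.add (hE1.conjTranspose_mul_mul_same R) using 1
    noncomm_ring
  · have h1 := (hRR.add (hE2.conjTranspose_mul_mul_same R))
    convert h1 using 1
    noncomm_ring
  · rw [hBB, hdiff, hdiff] at hE
    have h1 : (1 / m ^ 2) * frobSq (diagComm h S) ≤
        frobSq ((2 / m : ℂ) • (R * diagComm h S * R.conjTranspose)) := by
      simp only [frobSq, Finset.mul_sum]
      refine Finset.sum_le_sum fun x _ => Finset.sum_le_sum fun y _ => ?_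
      rw [Matrix.smul_apply, hconj, smul_eq_mul, norm_mul, norm_mul, norm_mul, norm_star, norm_div,
        Complex.norm_real, Complex.norm_ofNat, Real.norm_eq_abs, abs_of_pos hm]
      have h2 : 1 / 4 ≤ ‖r x‖ ^ 2 * ‖r y‖ ^ 2 := by
        have := mul_le_mul (hr x) (hr y) (by norm_num) (by positivity)
        linarith
      calc 1 / m ^ 2 * ‖diagComm h S x y‖ ^ 2
          = 4 / m ^ 2 * ‖diagComm h S x y‖ ^ 2 * (1 / 4) := by ring
        _ ≤ 4 / m ^ 2 * ‖diagComm h S x y‖ ^ 2 * (‖r x‖ ^ 2 * ‖r y‖ ^ 2) := by gcongr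
        _ = _ := by ring
    have h2 : (E * ((2 / m : ℂ) • (R * diagComm h (S * S) * R.conjTranspose))).trace.re =
        2 / m * (expect (diagComm h (S * S)) (R.conjTranspose * E * R)).re := by
      rw [Matrix.mul_smul, Matrix.trace_smul, smul_eq_mul,
        show (2 / m : ℂ) = ((2 / m : ℝ) : ℂ) by push_cast; rfl, Complex.re_ofReal_mul, expect]
      congr 2
      rw [Matrix.mul_assoc R, ← Matrix.mul_assoc E, Matrix.trace_mul_comm (E * R)]
      simp only [Matrix.mul_assoc]
    rw [h2] at hE
    have h3 := h1.trans hE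
    have h4 : (expect (S * S) (L * L)).re / (8 * m) ≤ m / 2 * (1 / m ^ 2 * frobSq (diagComm h S)) := by
      rw [show m / 2 * (1 / m ^ 2 * frobSq (diagComm h S)) =
        (4 * frobSq (diagComm h S)) / (8 * m) by field_simp; ring]
      gcongr
    refine h4.trans ?_
    calc _ ≤ m / 2 * (2 / m * (expect (diagComm h (S * S)) (R.conjTranspose * E * R)).re) := by
          gcongr
      _ = _ := by field_simp

theorem norm_expect_mul_sq_le {ρ A B : Matrix n n ℂ} (hρ : ρ.PosSemidef) (hA : A.IsHermitian)
    (hB : B.IsHermitian) :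
    ‖expect ρ (A * B)‖ ^ 2 ≤ (expect ρ (A * A)).re * (expect ρ (B * B)).re := by
  obtain ⟨S, hS, rfl⟩ := exists_posSemidef_sqrt hρ
  rw [← frobSq_mul_sqrt hA hS.1, ← frobSq_mul_sqrt hB hS.1]
  convert norm_trace_sq_le (A * S) (B * S) using 3
  rw [Matrix.conjTranspose_mul, hA.eq, hS.1.eq, expect, Matrix.mul_assoc S S,
    Matrix.trace_mul_comm S]
  simp only [Matrix.mul_assoc]

theorem diagComm_eq (h : n → ℝ) (X : Matrix n n ℂ) :
    diagComm h X = -Complex.I • (Matrix.diagonal (fun x => (h x : ℂ)) * X -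
      X * Matrix.diagonal (fun x => (h x : ℂ))) := by
  ext x y
  simp only [diagComm, Matrix.of_apply, Matrix.smul_apply, Matrix.sub_apply, Matrix.diagonal_mul,
    Matrix.mul_diagonal, smul_eq_mul]
  ring

theorem isHermitian_diagonal_ofReal (h : n → ℝ) :
    (Matrix.diagonal (fun x => (h x : ℂ))).IsHermitian := by
  rw [Matrix.IsHermitian, Matrix.diagonal_conjTranspose]
  congr 1; ext x; simp

/-- The **Robertson uncertainty relation** for a diagonal generator. -/
theorem sq_expect_diagComm_le {ρ X : Matrix n n ℂ} (hρ : IsState ρ) (hX : X.IsHermitian)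
    (h : n → ℝ) :
    (expect (diagComm h ρ) X).re ^ 2 ≤
      4 * (variance ρ (Matrix.diagonal fun x => (h x : ℂ)) * variance ρ X) := by
  have hH := isHermitian_diagonal_ofReal h
  rw [variance_eq_expect_centered hρ hH, variance_eq_expect_centered hρ hX, diagComm_eq]
  set H : Matrix n n ℂ := Matrix.diagonal fun x => (h x : ℂ)
  generalize (expect ρ H).re = α
  generalize (expect ρ X).re = β
  have hH' := isHermitian_sub_smul_one hH α
  have hX' := isHermitian_sub_smul_one hX β
  have h1 := norm_expect_mul_sq_le hρ.1 hH' hX'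
  have e1 : expect (-Complex.I • (H * ρ - ρ * H)) X =
      -Complex.I * (expect ρ ((X - (β : ℂ) • 1) * (H - (α : ℂ) • 1)) -
        expect ρ ((H - (α : ℂ) • 1) * (X - (β : ℂ) • 1))) := by
    have e2 : (H * (ρ * X)).trace = (ρ * (X * H)).trace := by
      rw [Matrix.trace_mul_comm, Matrix.mul_assoc]
    simp only [expect, Matrix.smul_mul, Matrix.sub_mul, Matrix.mul_sub, Matrix.mul_smul,
      Matrix.one_mul, Matrix.mul_one, Matrix.trace_sub, Matrix.trace_smul, smul_eq_mul,
      Matrix.mul_assoc, e2]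
    ring
  have e3 : expect ρ ((X - (β : ℂ) • 1) * (H - (α : ℂ) • 1)) =
      star (expect ρ ((H - (α : ℂ) • 1) * (X - (β : ℂ) • 1))) := by
    rw [expect, expect, ← Matrix.trace_conjTranspose, Matrix.conjTranspose_mul, hρ.1.1.eq,
      Matrix.conjTranspose_mul, hH'.eq, hX'.eq, Matrix.trace_mul_comm]
  rw [e1, e3]
  set z := expect ρ ((H - (α : ℂ) • 1) * (X - (β : ℂ) • 1))
  have e4 : (-Complex.I * (star z - z)).re = -2 * z.im := by
    simp [Complex.mul_re]; ring
  rw [e4]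
  have e5 : z.im ^ 2 ≤ ‖z‖ ^ 2 := by
    rw [← sq_abs]
    exact pow_le_pow_left₀ (abs_nonneg _) (Complex.abs_im_le_norm z) 2
  nlinarith

end CommutatorBound

/-! ### Z-rotations, derivatives of tensor powers and the effect of noise on speeds. -/

section

variable {Λ : Type*} [Fintype Λ] [DecidableEq Λ]

/-- The diagonal entries of the Pauli matrix `Z`. -/
def zSign : Fin 2 → ℝ := ![1, -1]

theorem zSign_sq (a : Fin 2) : zSign a * zSign a = 1 := by
  fin_cases a <;> simp [zSign]

theorem rotMatrix_eq (θ : ℝ) :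
    rotMatrix θ = Matrix.diagonal fun a => Complex.exp (-(Complex.I * θ * zSign a)) := by
  rw [rotMatrix]
  congr 1
  ext a
  fin_cases a <;> simp [zSign, mul_comm]

theorem zRotation_apply (θ : ℝ) (X : Matrix (Fin 2) (Fin 2) ℂ) (a b : Fin 2) :
    zRotation θ X a b = Complex.exp (-(Complex.I * θ * (zSign a - zSign b))) * X a b := by
  change (rotMatrix θ * X * (rotMatrix θ).conjTranspose) a b = _
  rw [rotMatrix_eq, Matrix.diagonal_conjTranspose, Matrix.mul_diagonal, Matrix.diagonal_mul,
    Pi.star_apply, Complex.star_def, ← Complex.exp_conj, mul_right_comm, ← Complex.exp_add]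
  congr 2
  simp
  ring

theorem rotMatrix_conjTranspose_mul (θ : ℝ) : (rotMatrix θ).conjTranspose * rotMatrix θ = 1 := by
  rw [rotMatrix_eq, Matrix.diagonal_conjTranspose, Matrix.diagonal_mul_diagonal,
    ← Matrix.diagonal_one]
  congr 1; ext a
  rw [Pi.star_apply, Complex.star_def, ← Complex.exp_conj, ← Complex.exp_add]
  simp

theorem isKraus_zRotation (θ : ℝ) : IsKraus (zRotation θ) :=
  ⟨1, fun _ => rotMatrix θ, fun X => by simp; rfl, by simp [rotMatrix_conjTranspose_mul]⟩

/-- The generator `X ↦ -i [Z, X]`. -/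
def commZ : QubitMap where
  toFun X := diagComm zSign X
  map_add' X Y := by
    ext a b
    simp [diagComm, mul_add]
  map_smul' c X := by
    ext a b
    simp [diagComm]
    ring

theorem commZ_single (u v : Fin 2) :
    commZ (Matrix.single u v 1) = (-Complex.I * (zSign u - zSign v)) • Matrix.single u v 1 := by
  ext a b
  change diagComm zSign (Matrix.single u v 1) a b = _
  simp only [diagComm, Matrix.of_apply, Matrix.smul_apply, smul_eq_mul, Matrix.single_apply]
  split_ifs with h
  · rw [h.1, h.2]
  · simp

theorem norm_commZ_coeff_le (u v : Fin 2) : ‖(-Complex.I * (zSign u - zSign v) : ℂ)‖ ≤ 2 := by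
  fin_cases u <;> fin_cases v <;> simp [zSign] <;> norm_num

/-- The derivative of `zRotation` at `θ`. -/
def zRotationDeriv (θ : ℝ) : QubitMap where
  toFun X := diagComm zSign (zRotation θ X)
  map_add' X Y := by
    ext a b
    simp [diagComm, mul_add]
  map_smul' c X := by
    ext a b
    simp [diagComm]
    ring

theorem hasDerivAt_exp_phase (θ : ℝ) (d c : ℂ) :
    HasDerivAt (fun t : ℝ => Complex.exp (-(Complex.I * t * d)) * c)
      (-Complex.I * d * (Complex.exp (-(Complex.I * θ * d)) * c)) θ := by
  have h1 : HasDerivAt (fun t : ℝ => -(Complex.I * (t : ℂ) * d)) (-(Complex.I * 1 * d)) θ :=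
    (((hasDerivAt_id θ).ofReal_comp.const_mul Complex.I).mul_const d).fun_neg
  refine (h1.cexp.mul_const c).congr_deriv ?_
  ring

theorem hasDerivAt_zRotation (θ : ℝ) (X : Matrix (Fin 2) (Fin 2) ℂ) (a b : Fin 2) :
    HasDerivAt (fun t => zRotation t X a b) (zRotationDeriv θ X a b) θ := by
  simp only [zRotation_apply]
  convert hasDerivAt_exp_phase θ (zSign a - zSign b) (X a b) using 1
  change diagComm zSign (zRotation θ X) a b = _
  rw [diagComm, Matrix.of_apply, zRotation_apply]

/-- The two terms of the commutator with Z are each sandwiched by unitaries up to a phase, giving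
the constant 1 + 1. -/
theorem factors_zRotationDeriv (θ : ℝ) : Factors (zRotationDeriv θ) 2 := by
  let Z : Matrix (Fin 2) (Fin 2) ℂ := Matrix.diagonal fun a => (zSign a : ℂ)
  have hZ : Z.conjTranspose = Z := by
    simp only [Z, Matrix.diagonal_conjTranspose]
    congr 1; ext a; simp
  have hZZ : Z * Z = 1 := by
    simp only [Z, Matrix.diagonal_mul_diagonal]
    rw [← Matrix.diagonal_one]
    congr 1; ext a
    rw [← Complex.ofReal_mul, zSign_sq, Complex.ofReal_one]
  have h1 : (Z * rotMatrix θ).conjTranspose * (Z * rotMatrix θ) = 1 := by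
    rw [Matrix.conjTranspose_mul, hZ, Matrix.mul_assoc, ← Matrix.mul_assoc Z, hZZ, Matrix.one_mul,
      rotMatrix_conjTranspose_mul]
  refine ⟨2, ![-Complex.I • (Z * rotMatrix θ), Complex.I • rotMatrix θ],
    ![rotMatrix θ, Z * rotMatrix θ], fun X => ?_, ?_, ?_⟩
  · simp only [Fin.sum_univ_two, Matrix.cons_val_zero, Matrix.cons_val_one]
    change diagComm zSign (rotMatrix θ * X * (rotMatrix θ).conjTranspose) = _
    rw [Matrix.conjTranspose_mul, hZ]
    simp only [Matrix.smul_mul]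
    rw [Matrix.mul_assoc Z, Matrix.mul_assoc Z, ← Matrix.mul_assoc _ _ Z]
    ext a b
    simp only [diagComm, Matrix.of_apply, Matrix.add_apply, Matrix.smul_apply, smul_eq_mul, Z,
      Matrix.diagonal_mul, Matrix.mul_diagonal]
    ring
  · simp only [Fin.sum_univ_two, Matrix.cons_val_zero, Matrix.cons_val_one,
      Matrix.conjTranspose_smul, Matrix.smul_mul, Matrix.mul_smul, smul_smul, h1,
      rotMatrix_conjTranspose_mul, ← add_smul]
    congr 1
    simp
    norm_num
  · simp only [Fin.sum_univ_two, Matrix.cons_val_zero, Matrix.cons_val_one, h1,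
      rotMatrix_conjTranspose_mul]
    rw [← two_smul ℂ]; norm_num

/-- The diagonal entries of `∑ Z_i`. -/
def totalZ (x : Λ → Fin 2) : ℝ := ∑ i, zSign (x i)

theorem abs_totalZ_le (x : Λ → Fin 2) : |totalZ x| ≤ Fintype.card Λ := by
  refine (Finset.abs_sum_le_sum_abs _ _).trans ?_
  have : ∀ i, |zSign (x i)| = 1 := fun i => by
    generalize x i = a
    fin_cases a <;> simp [zSign]
  simp [this]

theorem tensorPower_zRotation_apply (t : ℝ) (ρ : Matrix (Λ → Fin 2) (Λ → Fin 2) ℂ)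
    (x y : Λ → Fin 2) :
    tensorPower (zRotation t) ρ x y =
      Complex.exp (-(Complex.I * t * (totalZ x - totalZ y))) * ρ x y := by
  have h : ∀ u v : Λ → Fin 2, ∏ i, zRotation t (Matrix.single (u i) (v i) 1) (x i) (y i) =
      Complex.exp (-(Complex.I * t * (totalZ x - totalZ y))) * Matrix.single u v (1 : ℂ) x y := by
    intro u v
    simp only [zRotation_apply, Finset.prod_mul_distrib]
    rw [single_eq_kron, kron, Matrix.of_apply, ← Complex.exp_sum]
    congr 2
    simp only [totalZ]
    push_cast
    rw [Finset.sum_neg_distrib, ← Finset.mul_sum, Finset.sum_sub_distrib]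
  simp only [tensorPower, Matrix.of_apply, h, Matrix.single_apply]
  simp [ite_and]

theorem hasDerivAt_tensorPower_zRotation (θ : ℝ) (ρ : Matrix (Λ → Fin 2) (Λ → Fin 2) ℂ)
    (x y : Λ → Fin 2) :
    HasDerivAt (fun t => tensorPower (zRotation t) ρ x y)
      (diagComm totalZ (tensorPower (zRotation θ) ρ) x y) θ := by
  simp only [tensorPower_zRotation_apply]
  convert hasDerivAt_exp_phase θ (totalZ x - totalZ y) (ρ x y) using 1
  rw [diagComm, Matrix.of_apply, tensorPower_zRotation_apply]

theorem hasDerivAt_tensorPower {Ψ : ℝ → QubitMap} {θ : ℝ} {Ψ' : QubitMap}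
    (h : ∀ X a b, HasDerivAt (fun t => Ψ t X a b) (Ψ' X a b) θ)
    (ρ : Matrix (Λ → Fin 2) (Λ → Fin 2) ℂ) (x y : Λ → Fin 2) :
    HasDerivAt (fun t => tensorPower (Ψ t) ρ x y)
      ((∑ i, tensorMap (Function.update (fun _ => Ψ θ) i Ψ') ρ) x y) θ := by
  have h1 : (∑ i, tensorMap (Function.update (fun _ => Ψ θ) i Ψ') ρ) x y =
      ∑ u, ∑ v, (∑ i, (∏ j ∈ Finset.univ.erase i, Ψ θ (Matrix.single (u j) (v j) 1) (x j) (y j)) •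
        Ψ' (Matrix.single (u i) (v i) 1) (x i) (y i)) * ρ u v := by
    simp only [Matrix.sum_apply, tensorMap, Matrix.of_apply, Finset.sum_mul]
    rw [Finset.sum_comm]
    refine Finset.sum_congr rfl fun u _ => ?_
    rw [Finset.sum_comm]
    refine Finset.sum_congr rfl fun v _ => Finset.sum_congr rfl fun i _ => ?_
    rw [← Finset.mul_prod_erase _ _ (Finset.mem_univ i), Function.update_self, smul_eq_mul, mul_comm
      (∏ j ∈ Finset.univ.erase i, _) (Ψ' _ _ _)]
    congr 2
    refine Finset.prod_congr rfl fun j hj => ?_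
    rw [Function.update_of_ne (Finset.ne_of_mem_erase hj)]
  rw [h1]
  simp only [tensorPower, Matrix.of_apply]
  refine HasDerivAt.fun_sum fun u _ => HasDerivAt.fun_sum fun v _ => HasDerivAt.mul_const ?_ _
  exact HasDerivAt.fun_finsetProd fun i _ => h _ _ _

/-- Matrix units are eigenvectors of each one-qubit commutator, and the eigenvalues add up to that
of the total generator. -/
theorem tensorPower_diagComm (Φ : QubitMap) (ρ : Matrix (Λ → Fin 2) (Λ → Fin 2) ℂ) :
    tensorPower Φ (diagComm totalZ ρ) =
      ∑ i, tensorMap (Function.update (fun _ => Φ) i (Φ ∘ₗ commZ)) ρ := by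
  ext x y
  simp only [tensorPower, Matrix.sum_apply, tensorMap, Matrix.of_apply]
  conv_rhs => rw [Finset.sum_comm]
  refine Finset.sum_congr rfl fun u _ => ?_
  conv_rhs => rw [Finset.sum_comm]
  refine Finset.sum_congr rfl fun v _ => ?_
  have h : ∀ i : Λ, ∏ j, (Function.update (fun _ => Φ) i (Φ ∘ₗ commZ) : Λ → QubitMap)
      j (Matrix.single (u j) (v j) 1) (x j) (y j) = (-Complex.I * (zSign (u i) - zSign (v i))) *
        ∏ j, Φ (Matrix.single (u j) (v j) 1) (x j) (y j) := by
    intro i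
    rw [← Finset.mul_prod_erase _ _ (Finset.mem_univ i), Function.update_self,
      ← Finset.mul_prod_erase _ (fun j => Φ (Matrix.single (u j) (v j) 1) (x j) (y j))
        (Finset.mem_univ i), LinearMap.comp_apply, commZ_single, map_smul, Matrix.smul_apply,
      smul_eq_mul, mul_assoc]
    congr 2
    refine Finset.prod_congr rfl fun j hj => ?_
    rw [Function.update_of_ne (Finset.ne_of_mem_erase hj)]
  simp only [h, diagComm, Matrix.of_apply, totalZ]
  push_cast
  rw [← Finset.sum_mul, ← Finset.sum_mul, ← Finset.mul_sum, Finset.sum_sub_distrib]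
  ring

theorem prod_update_one (i : Λ) (c : ℝ) : ∏ j, Function.update (fun _ : Λ => (1 : ℝ)) i c j = c := by
  rw [Finset.prod_update_of_mem (Finset.mem_univ i)]; simp

theorem norm_expect_tensorMap_update_le {Ψ : Λ → QubitMap} (hΨ : ∀ i, Factors (Ψ i) 1) (i : Λ)
    {Φ : QubitMap} {c : ℝ} (hc : 0 ≤ c) (hΦ : Factors Φ c)
    {ρ O : Matrix (Λ → Fin 2) (Λ → Fin 2) ℂ} (hρ : IsState ρ) (hO : opNorm O ≤ 1) :
    ‖expect (tensorMap (Function.update Ψ i Φ) ρ) O‖ ≤ c := by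
  rw [← prod_update_one i c]
  refine norm_expect_tensorMap_le (fun j => ?_) (fun j => ?_) hρ hO
  · by_cases h : j = i
    · subst h; simpa using hc
    · simp [Function.update_of_ne h]
  · by_cases h : j = i
    · subst h; simpa using hΦ
    · simpa [Function.update_of_ne h] using hΨ j

theorem norm_expect_tensorMap_update_update_le {Ψ : Λ → QubitMap} (hΨ : ∀ i, Factors (Ψ i) 1)
    {i j : Λ} (hij : j ≠ i) {Φ Φ' : QubitMap} {c c' : ℝ} (hc : 0 ≤ c) (hΦ : Factors Φ c)
    (hc' : 0 ≤ c') (hΦ' : Factors Φ' c')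
    {ρ O : Matrix (Λ → Fin 2) (Λ → Fin 2) ℂ} (hρ : IsState ρ) (hO : opNorm O ≤ 1) :
    ‖expect (tensorMap (Function.update (Function.update Ψ i Φ) j Φ') ρ) O‖ ≤ c * c' := by
  have hp : ∏ k, Function.update (Function.update (fun _ : Λ => (1 : ℝ)) i c) j c' k = c * c' := by
    rw [Finset.prod_update_of_mem (Finset.mem_univ j), Finset.prod_update_of_mem (by simp [hij.symm])]
    simp [mul_comm]
  rw [← hp]
  refine norm_expect_tensorMap_le (fun k => ?_) (fun k => ?_) hρ hO
  · by_cases h : k = j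
    · subst h; simpa using hc'
    · rw [Function.update_of_ne h]
      by_cases h : k = i
      · subst h; simpa using hc
      · simp [Function.update_of_ne h]
  · by_cases h : k = j
    · subst h; simpa using hΦ'
    · rw [Function.update_of_ne h, Function.update_of_ne h]
      by_cases h : k = i
      · subst h; simpa using hΦ
      · simpa [Function.update_of_ne h] using hΨ k

theorem expect_sub (ρ σ O : Matrix (Λ → Fin 2) (Λ → Fin 2) ℂ) :
    expect (ρ - σ) O = expect ρ O - expect σ O := by
  simp [expect, Matrix.sub_mul]

/-- Telescoping: replacing the map on the other qubits costs at most `ε` per qubit. -/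
theorem norm_expect_tensorMap_update_sub_le {Φ Φ' Θ : QubitMap} {ε : ℝ} (hε : 0 ≤ ε)
    (hΦ : Factors Φ 1) (hΦ' : Factors Φ' 1) (hd : Factors (Φ - Φ') ε) {c : ℝ} (hc : 0 ≤ c)
    (hΘ : Factors Θ c) (i : Λ) {ρ O : Matrix (Λ → Fin 2) (Λ → Fin 2) ℂ} (hρ : IsState ρ)
    (hO : opNorm O ≤ 1) :
    ‖expect (tensorMap (Function.update (fun _ => Φ) i Θ) ρ) O -
      expect (tensorMap (Function.update (fun _ => Φ') i Θ) ρ) O‖ ≤ Fintype.card Λ * (c * ε) := by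
  -- Induction on the set `s` of qubits already carrying Φ.
  have key : ∀ s : Finset Λ,
      ‖expect (tensorMap (Function.update (fun k => if k ∈ s then Φ else Φ') i Θ) ρ) O -
        expect (tensorMap (Function.update (fun _ => Φ') i Θ) ρ) O‖ ≤ s.card * (c * ε) := by
    intro s
    induction s using Finset.induction_on with
    | empty => simp
    | insert j s hj ih =>
      rw [Finset.card_insert_of_notMem hj]
      push_cast
      set f : Λ → QubitMap := fun k => if k ∈ s then Φ else Φ' with hf
      have hf1 : ∀ k, Factors (f k) 1 := fun k => by
        simp only [hf]; split_ifs <;> assumption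
      have e1 : (fun k => if k ∈ insert j s then Φ else Φ') = Function.update f j Φ := by
        ext1 k
        by_cases h : k = j
        · subst h; simp
        · simp [hf, h]
      have e2 : f = Function.update f j Φ' := by
        ext1 k
        by_cases h : k = j
        · subst h; simp [hf, hj]
        · simp [Function.update_of_ne h]
      rw [e1]
      -- At site `i` the map is overwritten by Θ, so that replacement changes nothing.
      by_cases hij : j = i
      · subst hij
        rw [Function.update_idem]
        nlinarith [mul_nonneg hc hε]
      · rw [Function.update_comm hij]
        have h1 := norm_expect_tensorMap_update_update_le hf1 hij hc hΘ hε hd hρ hO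
        rw [tensorMap_update_sub, expect_sub, ← Function.update_comm hij (f := f) (v := Φ'), ← e2] at h1
        refine (norm_sub_le_norm_sub_add_norm_sub _
          (expect (tensorMap (Function.update f i Θ) ρ) O) _).trans ?_
        linarith
  simpa using key Finset.univ

/-- The speed of an expectation under the noisy evolution is close to the one under the noiseless
evolution. -/
theorem IsNoisyEvolution.exists_hasDerivAt {K p : ℝ} (hKp : 0 ≤ K * p) {𝒩 : ℝ → QubitMap}
    (h : IsNoisyEvolution K p 𝒩) {ρ : Matrix (Λ → Fin 2) (Λ → Fin 2) ℂ} (hρ : IsState ρ) (θ : ℝ) :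
    ∃ D : Matrix (Λ → Fin 2) (Λ → Fin 2) ℂ,
      (∀ x y, HasDerivAt (fun t => tensorPower (𝒩 t) ρ x y) (D x y) θ) ∧
      ∀ O, opNorm O ≤ 1 → ‖expect D O - expect (diagComm totalZ (tensorPower (zRotation θ) ρ)) O‖ ≤
        24 * (Fintype.card Λ : ℝ) ^ 2 * (K * p) ∧
      ‖expect D O - expect (tensorPower (𝒩 θ) (diagComm totalZ ρ)) O‖ ≤
        24 * (Fintype.card Λ : ℝ) * (K * p) := by
  obtain ⟨hch, hdia, Δ', hΔ', hdia'⟩ := h θ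
  have hN : Factors (𝒩 θ) 1 := hch.isKraus.factors
  have hU : Factors (zRotation θ) 1 := (isKraus_zRotation θ).factors
  have hΔ : Factors (𝒩 θ - zRotation θ) (8 * (K * p)) :=
    factors_of_norm_apply_single_le hKp (norm_apply_single_le_of_diamondNorm_le hKp hdia)
  have hΔ'f : Factors Δ' (8 * (K * p)) :=
    factors_of_norm_apply_single_le hKp (norm_apply_single_le_of_diamondNorm_le hKp hdia')
  have hN' : ∀ X a b, HasDerivAt (fun t => 𝒩 t X a b) ((Δ' + zRotationDeriv θ) X a b) θ := by
    intro X a b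
    have e : (fun t => 𝒩 t X a b) = (fun t => (𝒩 t - zRotation t) X a b + zRotation t X a b) := by
      ext t
      simp
    rw [e]
    exact (hΔ' X a b).fun_add (hasDerivAt_zRotation θ X a b)
  refine ⟨_, hasDerivAt_tensorPower hN' ρ, fun O hO => ?_⟩
  have hU' : diagComm totalZ (tensorPower (zRotation θ) ρ) =
      ∑ i, tensorMap (Function.update (fun _ => zRotation θ) i (zRotationDeriv θ)) ρ := by
    ext x y
    exact (hasDerivAt_tensorPower_zRotation θ ρ x y).unique
      (hasDerivAt_tensorPower (hasDerivAt_zRotation θ) ρ x y)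
  have e : ∀ f : Λ → Matrix (Λ → Fin 2) (Λ → Fin 2) ℂ, expect (∑ i, f i) O = ∑ i, expect (f i) O := by
    intro f
    simp [expect, Finset.sum_mul, Matrix.trace_sum]
  refine ⟨?_, ?_⟩
  swap
  -- A rotation commutes with its generator, so the one-qubit discrepancy is Δ' - Δ ∘ `commZ`, with
  -- entries at most Kp + 2Kp. All other qubits carry the same noisy map, so no telescoping occurs
  -- and the bound is linear in the number of qubits.
  · have hzero : ∀ X, zRotationDeriv θ X = zRotation θ (commZ X) := by
      intro X
      ext a b
      change diagComm zSign (zRotation θ X) a b = zRotation θ (diagComm zSign X) a b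
      simp only [diagComm, Matrix.of_apply, zRotation_apply]
      ring
    have hf : Factors (Δ' + zRotationDeriv θ - 𝒩 θ ∘ₗ commZ) (8 * (3 * (K * p))) := by
      refine factors_of_norm_apply_single_le (by positivity) fun u v x y => ?_
      have e1 : (Δ' + zRotationDeriv θ - 𝒩 θ ∘ₗ commZ) (Matrix.single u v 1) x y =
          Δ' (Matrix.single u v 1) x y - (-Complex.I * (zSign u - zSign v)) *
            (𝒩 θ - zRotation θ) (Matrix.single u v 1) x y := by
        simp only [LinearMap.sub_apply, LinearMap.add_apply, LinearMap.comp_apply, hzero,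
          commZ_single, map_smul, Matrix.sub_apply, Matrix.add_apply, Matrix.smul_apply,
          smul_eq_mul]
        ring
      rw [e1]
      refine (norm_sub_le _ _).trans ?_
      rw [norm_mul]
      have h1 := norm_apply_single_le_of_diamondNorm_le hKp hdia u v x y
      have h2 := norm_apply_single_le_of_diamondNorm_le hKp hdia' u v x y
      have h3 := mul_le_mul (norm_commZ_coeff_le u v) h1 (norm_nonneg _) (by norm_num)
      linarith
    rw [tensorPower_diagComm, e, e, ← Finset.sum_sub_distrib]
    refine (norm_sum_le _ _).trans ((Finset.sum_le_sum fun i _ => ?_).trans (?_ :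
      ∑ i : Λ, 8 * (3 * (K * p)) ≤ _))
    · rw [← expect_sub, ← tensorMap_update_sub]
      exact norm_expect_tensorMap_update_le (fun _ => hN) i (by positivity) hf hρ hO
    · rw [Finset.sum_const, Finset.card_univ, nsmul_eq_mul]
      exact le_of_eq (by ring)
  rw [hU', e, e, ← Finset.sum_sub_distrib]
  -- 8Kp for the error of the differentiated factor, and 2 · 8Kp per qubit for exchanging the
  -- remaining maps, 2 being the constant of the rotation's derivative.
  have hi : ∀ i : Λ, ‖expect (tensorMap (Function.update (fun _ => 𝒩 θ) i
        (Δ' + zRotationDeriv θ)) ρ) O -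
      expect (tensorMap (Function.update (fun _ => zRotation θ) i (zRotationDeriv θ)) ρ) O‖ ≤
      8 * (K * p) + Fintype.card Λ * (2 * (8 * (K * p))) := by
    intro i
    have h1 := norm_expect_tensorMap_update_le (fun _ => hN) i (by positivity) hΔ'f hρ hO
    rw [show Δ' = (Δ' + zRotationDeriv θ) - zRotationDeriv θ by simp, tensorMap_update_sub,
      expect_sub] at h1
    have h2 := norm_expect_tensorMap_update_sub_le (by positivity) hN hU hΔ (by norm_num)
      (factors_zRotationDeriv θ) i hρ hO
    exact (norm_sub_le_norm_sub_add_norm_sub _ _ _).trans (add_le_add h1 h2)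
  refine (norm_sum_le _ _).trans ((Finset.sum_le_sum fun i _ => hi i).trans ?_)
  rw [Finset.sum_const, Finset.card_univ, nsmul_eq_mul]
  have hM : (Fintype.card Λ : ℝ) ≤ (Fintype.card Λ : ℝ) ^ 2 := by
    exact_mod_cast Nat.le_self_pow (by norm_num) _
  nlinarith

end

/-! ### Operators inside a group and reduced states. -/

section Embedding

variable {Λ Γ : Type*} [Fintype Λ] [DecidableEq Λ] [DecidableEq Γ] (grp : Λ → Γ) (I : Γ)

theorem embed_eq_submatrix (A : Matrix (GroupBasis grp I) (GroupBasis grp I) ℂ) :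
    embed grp I A = (A ⊗ₖ (1 : Matrix ({i : Λ // ¬ grp i = I} → Fin 2) _ ℂ)).submatrix
      (Equiv.piEquivPiSubtypeProd (fun i => grp i = I) (fun _ => Fin 2))
      (Equiv.piEquivPiSubtypeProd (fun i => grp i = I) (fun _ => Fin 2)) := by
  ext x y
  simp only [embed, Matrix.of_apply, Matrix.submatrix_apply, Matrix.kroneckerMap_apply,
    Equiv.piEquivPiSubtypeProd_apply, Matrix.one_apply, funext_iff, Subtype.forall, mul_ite,
    mul_one, mul_zero]

theorem embed_mul (A B : Matrix (GroupBasis grp I) (GroupBasis grp I) ℂ) :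
    embed grp I (A * B) = embed grp I A * embed grp I B := by
  rw [embed_eq_submatrix, embed_eq_submatrix, embed_eq_submatrix, Matrix.submatrix_mul_equiv,
    ← Matrix.mul_kronecker_mul, Matrix.one_mul]

theorem embed_add (A B : Matrix (GroupBasis grp I) (GroupBasis grp I) ℂ) :
    embed grp I (A + B) = embed grp I A + embed grp I B := by
  rw [embed_eq_submatrix, embed_eq_submatrix, embed_eq_submatrix, Matrix.add_kronecker,
    Matrix.submatrix_add]; rfl

theorem embed_smul (c : ℂ) (A : Matrix (GroupBasis grp I) (GroupBasis grp I) ℂ) :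
    embed grp I (c • A) = c • embed grp I A := by
  rw [embed_eq_submatrix, embed_eq_submatrix, Matrix.smul_kronecker, Matrix.submatrix_smul]; rfl

theorem embed_zero : embed grp I 0 = 0 := by
  have := embed_smul grp I 0 0
  simpa using this

theorem embed_one : embed grp I 1 = 1 := by
  rw [embed_eq_submatrix, Matrix.one_kronecker_one, Matrix.submatrix_one_equiv]

theorem embed_conjTranspose (A : Matrix (GroupBasis grp I) (GroupBasis grp I) ℂ) :
    embed grp I A.conjTranspose = (embed grp I A).conjTranspose := by
  rw [embed_eq_submatrix, embed_eq_submatrix, Matrix.conjTranspose_submatrix,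
    Matrix.conjTranspose_kronecker, Matrix.conjTranspose_one]

theorem posSemidef_embed {A : Matrix (GroupBasis grp I) (GroupBasis grp I) ℂ} (h : A.PosSemidef) :
    (embed grp I A).PosSemidef := by
  rw [embed_eq_submatrix]
  exact (h.kronecker Matrix.PosSemidef.one).submatrix _

theorem opNorm_embed_le_one {A : Matrix (GroupBasis grp I) (GroupBasis grp I) ℂ}
    (h : opNorm A ≤ 1) : opNorm (embed grp I A) ≤ 1 := by
  rw [opNorm_le_one_iff] at h ⊢
  have := posSemidef_embed grp I h
  rwa [sub_eq_add_neg, embed_add, embed_one, ← neg_one_smul ℂ, embed_smul, neg_one_smul,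
    ← sub_eq_add_neg, embed_mul, embed_conjTranspose] at this

/-- A family of qubit operators on a group, extended by the identity. -/
def extendOne (a : {i : Λ // grp i = I} → Matrix (Fin 2) (Fin 2) ℂ) (i : Λ) :
    Matrix (Fin 2) (Fin 2) ℂ :=
  if h : grp i = I then a ⟨i, h⟩ else 1

theorem embed_kron (a : {i : Λ // grp i = I} → Matrix (Fin 2) (Fin 2) ℂ) :
    embed grp I (kron a) = kron (extendOne grp I a) := by
  have hone : (1 : Matrix ({i : Λ // ¬ grp i = I} → Fin 2) _ ℂ) = kron fun _ => 1 := kron_one.symm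
  rw [embed_eq_submatrix, hone]
  ext x y
  simp only [kron, Matrix.of_apply, Matrix.submatrix_apply, Matrix.kroneckerMap_apply,
    Equiv.piEquivPiSubtypeProd_apply]
  rw [← Fintype.prod_subtype_mul_prod_subtype (fun i => grp i = I)]
  congr 1
  · exact Finset.prod_congr rfl fun i _ => by rw [extendOne, dif_pos i.2]
  · exact Finset.prod_congr rfl fun i _ => by rw [extendOne, dif_neg i.2]

/-- Partial trace is the adjoint of tensoring with the identity. -/
theorem expect_embed (σ : Matrix (Λ → Fin 2) (Λ → Fin 2) ℂ)
    (A : Matrix (GroupBasis grp I) (GroupBasis grp I) ℂ) :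
    expect σ (embed grp I A) = expect (reduced grp I σ) A := by
  let e := Equiv.piEquivPiSubtypeProd (fun i => grp i = I) (fun _ => Fin 2)
  have hE : ∀ p q, embed grp I A (e.symm p) (e.symm q) =
      A p.1 q.1 * (1 : Matrix ({i : Λ // ¬ grp i = I} → Fin 2) _ ℂ) p.2 q.2 := by
    intro p q
    rw [embed_eq_submatrix]
    change (A ⊗ₖ (1 : Matrix ({i : Λ // ¬ grp i = I} → Fin 2) _ ℂ)) (e (e.symm p)) (e (e.symm q)) = _
    rw [e.apply_symm_apply, e.apply_symm_apply]
    rfl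
  have hR : ∀ s t, reduced grp I σ s t = ∑ u, σ (e.symm (s, u)) (e.symm (t, u)) := fun _ _ => rfl
  simp only [expect, Matrix.trace, Matrix.diag_apply, Matrix.mul_apply, hR, Finset.sum_mul]
  rw [← e.symm.sum_comp]
  simp_rw [← e.symm.sum_comp (fun y => σ _ y * _), hE, Fintype.sum_prod_type]
  refine Finset.sum_congr rfl fun s _ => ?_
  rw [Finset.sum_comm]
  refine Finset.sum_congr rfl fun t _ => Finset.sum_congr rfl fun u _ => ?_
  simp only [Matrix.one_apply, mul_ite, mul_one, mul_zero, Finset.sum_ite_eq', Finset.mem_univ,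
    if_true]

theorem isState_reduced {ρ : Matrix (Λ → Fin 2) (Λ → Fin 2) ℂ} (h : IsState ρ) :
    IsState (reduced grp I ρ) := by
  refine ⟨?_, ?_⟩
  · have : reduced grp I ρ = ∑ u : {i : Λ // ¬ grp i = I} → Fin 2, ρ.submatrix
        (fun s => (Equiv.piEquivPiSubtypeProd (fun i => grp i = I) (fun _ => Fin 2)).symm (s, u))
        (fun s => (Equiv.piEquivPiSubtypeProd (fun i => grp i = I) (fun _ => Fin 2)).symm (s, u)) := by
      ext s t
      simp [reduced, Matrix.sum_apply]
    rw [this]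
    exact Matrix.posSemidef_sum _ fun u _ => h.1.submatrix _
  · have := expect_embed grp I ρ 1
    rw [embed_one, h.expect_one, expect, Matrix.mul_one] at this
    exact this.symm

end Embedding

/-! ### The Heisenberg picture. -/

section Dual

variable {Λ : Type*} [Fintype Λ] [DecidableEq Λ]

/-- The Heisenberg picture of a map. -/
def dualMap (Φ : QubitMap) : QubitMap where
  toFun Y := Matrix.of fun x y => (Φ (Matrix.single y x 1) * Y).trace
  map_add' X Y := by ext x y; simp [Matrix.mul_add]
  map_smul' c X := by ext x y; simp

theorem dualMap_single (Φ : QubitMap) (u v x y : Fin 2) :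
    dualMap Φ (Matrix.single u v 1) x y = Φ (Matrix.single y x 1) v u := by
  simp [dualMap, Matrix.trace_mul_single]

theorem expect_tensorPower (Φ : QubitMap) (ρ A : Matrix (Λ → Fin 2) (Λ → Fin 2) ℂ) :
    expect (tensorPower Φ ρ) A = expect ρ (tensorPower (dualMap Φ) A) := by
  simp only [expect, Matrix.trace, Matrix.diag_apply, Matrix.mul_apply, tensorPower,
    Matrix.of_apply, dualMap_single, Finset.sum_mul, Finset.mul_sum]
  calc _ = ∑ v : Λ → Fin 2, ∑ y : Λ → Fin 2, ∑ x : Λ → Fin 2, ∑ u : Λ → Fin 2,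
      (∏ i, Φ (Matrix.single (y i) (x i) 1) (v i) (u i)) * ρ y x * A u v := by
        refine Finset.sum_congr rfl fun v _ => ?_
        rw [Finset.sum_comm]
        refine Finset.sum_congr rfl fun y _ => ?_
        rw [Finset.sum_comm]
    _ = _ := by
        rw [Finset.sum_comm]
        refine Finset.sum_congr rfl fun y _ => ?_
        rw [Finset.sum_comm]
        refine Finset.sum_congr rfl fun x _ => ?_
        rw [Finset.sum_comm]
        refine Finset.sum_congr rfl fun u _ => Finset.sum_congr rfl fun v _ => by ring

theorem tensorPower_add (Φ : QubitMap) (A B : Matrix (Λ → Fin 2) (Λ → Fin 2) ℂ) :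
    tensorPower Φ (A + B) = tensorPower Φ A + tensorPower Φ B := by
  ext x y
  simp [tensorPower, mul_add, Finset.sum_add_distrib]

theorem tensorPower_smul (Φ : QubitMap) (c : ℂ) (A : Matrix (Λ → Fin 2) (Λ → Fin 2) ℂ) :
    tensorPower Φ (c • A) = c • tensorPower Φ A := by
  ext x y
  simp [tensorPower, Finset.mul_sum, mul_left_comm]

theorem tensorPower_kron (Φ : QubitMap) (a : Λ → Matrix (Fin 2) (Fin 2) ℂ) :
    tensorPower Φ (kron a) = kron fun i => Φ (a i) := by
  ext x y
  simp only [tensorPower, kron, Matrix.of_apply, ← Finset.prod_mul_distrib]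
  simp_rw [qubitMap_apply_eq_sum Φ (a _)]
  rw [Finset.prod_univ_sum, Fintype.piFinset_univ]
  refine Finset.sum_congr rfl fun u _ => ?_
  rw [Finset.prod_univ_sum, Fintype.piFinset_univ]
  exact Finset.sum_congr rfl fun v _ => Finset.prod_congr rfl fun i _ => mul_comm _ _

/-- Product operators span, because matrix units are products. -/
theorem kron_induction {P : Matrix (Λ → Fin 2) (Λ → Fin 2) ℂ → Prop}
    (hk : ∀ a, P (kron a)) (hadd : ∀ A B, P A → P B → P (A + B))
    (hsmul : ∀ (c : ℂ) A, P A → P (c • A)) (A : Matrix (Λ → Fin 2) (Λ → Fin 2) ℂ) : P A := by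
  induction A using Matrix.induction_on' with
  | h_zero => simpa using hsmul 0 _ (hk fun _ => 1)
  | h_add A B hA hB => exact hadd A B hA hB
  | h_std_basis x y c =>
    have := hsmul c _ (hk fun i => Matrix.single (x i) (y i) (1 : ℂ))
    rw [← single_eq_kron, Matrix.smul_single] at this
    simpa using this

theorem IsKraus.trace_eq {Φ : QubitMap} (h : IsKraus Φ) (X : Matrix (Fin 2) (Fin 2) ℂ) :
    (Φ X).trace = X.trace := by
  obtain ⟨m, A, h1, h2⟩ := h
  rw [h1, Matrix.trace_sum]
  simp_rw [Matrix.trace_mul_comm (A _ * X), ← Matrix.mul_assoc]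
  rw [← Matrix.trace_sum, ← Matrix.sum_mul, h2, Matrix.one_mul]

theorem IsKraus.dualMap_one {Φ : QubitMap} (h : IsKraus Φ) : dualMap Φ 1 = 1 := by
  ext x y
  change (Φ (Matrix.single y x 1) * 1).trace = _
  rw [Matrix.mul_one, h.trace_eq]
  by_cases hxy : y = x
  · subst hxy; simp
  · rw [Matrix.trace_single_eq_of_ne _ _ _ hxy, Matrix.one_apply_ne (Ne.symm hxy)]

theorem IsKraus.tensorPower_dualMap_one {Φ : QubitMap} (h : IsKraus Φ) :
    tensorPower (dualMap Φ) (1 : Matrix (Λ → Fin 2) (Λ → Fin 2) ℂ) = 1 := by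
  rw [← kron_one, tensorPower_kron]
  simp only [h.dualMap_one]

theorem tensorPower_dualMap_eq {Φ : QubitMap} {ι : Type*} [Fintype ι]
    {B : ι → Matrix (Λ → Fin 2) (Λ → Fin 2) ℂ}
    (h : ∀ ρ, tensorPower Φ ρ = ∑ k, B k * ρ * (B k).conjTranspose)
    (A : Matrix (Λ → Fin 2) (Λ → Fin 2) ℂ) :
    tensorPower (dualMap Φ) A = ∑ k, (B k).conjTranspose * A * B k := by
  rw [Matrix.ext_iff_trace_mul_left]
  intro ρ
  change expect _ _ = _
  rw [← expect_tensorPower, h, expect, Matrix.sum_mul, Matrix.mul_sum, Matrix.trace_sum,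
    Matrix.trace_sum]
  refine Finset.sum_congr rfl fun k _ => ?_
  rw [Matrix.mul_assoc, Matrix.mul_assoc, Matrix.trace_mul_comm]
  simp only [Matrix.mul_assoc]

theorem IsKraus.posSemidef_tensorPower_dualMap {Φ : QubitMap} (h : IsKraus Φ)
    {A : Matrix (Λ → Fin 2) (Λ → Fin 2) ℂ} (hA : A.PosSemidef) :
    (tensorPower (dualMap Φ) A).PosSemidef := by
  obtain ⟨ι, _, B, h1, -⟩ := h.exists_tensorPower_eq (Λ := Λ)
  rw [tensorPower_dualMap_eq h1]
  exact Matrix.posSemidef_sum _ fun k _ => hA.conjTranspose_mul_mul_same _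

theorem IsKraus.isHermitian_tensorPower_dualMap {Φ : QubitMap} (h : IsKraus Φ)
    {A : Matrix (Λ → Fin 2) (Λ → Fin 2) ℂ} (hA : A.IsHermitian) :
    (tensorPower (dualMap Φ) A).IsHermitian := by
  obtain ⟨ι, _, B, h1, -⟩ := h.exists_tensorPower_eq (Λ := Λ)
  rw [tensorPower_dualMap_eq h1]
  simp only [Matrix.IsHermitian, Matrix.conjTranspose_sum, Matrix.conjTranspose_mul,
    Matrix.conjTranspose_conjTranspose, hA.eq, Matrix.mul_assoc]

/-- A consequence of the Kadison-Schwarz inequality: variances decrease in the Heisenberg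
picture. -/
theorem IsKraus.variance_dualMap_le {Φ : QubitMap} (h : IsKraus Φ)
    {ρ X : Matrix (Λ → Fin 2) (Λ → Fin 2) ℂ} (hρ : ρ.PosSemidef) (hX : X.IsHermitian) :
    variance ρ (tensorPower (dualMap Φ) X) ≤ variance (tensorPower Φ ρ) X := by
  obtain ⟨S, hS, hSρ⟩ := exists_posSemidef_sqrt hρ
  obtain ⟨ι, _, B, h1, h2⟩ := h.exists_tensorPower_eq (Λ := Λ)
  have hXt := h.isHermitian_tensorPower_dualMap hX
  have h3 := tensorPower_dualMap_eq h1 X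
  have h4 := tensorPower_dualMap_eq h1 (X * X)
  rw [variance, variance, corr, corr, expect_tensorPower, expect_tensorPower, tensorPower_add]
  set Y := tensorPower (dualMap Φ) X
  -- The Kadison-Schwarz defect written as a sum of squares over the Kraus operators `B k`.
  have key : ∑ k, (X * B k - B k * Y).conjTranspose * (X * B k - B k * Y) =
      tensorPower (dualMap Φ) (X * X) - Y * Y := by
    have e : ∀ k, (X * B k - B k * Y).conjTranspose * (X * B k - B k * Y) =
        (B k).conjTranspose * (X * X) * B k - (B k).conjTranspose * X * B k * Y -
          Y * ((B k).conjTranspose * X * B k) + Y * ((B k).conjTranspose * B k) * Y := by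
      intro k
      rw [Matrix.conjTranspose_sub, Matrix.conjTranspose_mul, Matrix.conjTranspose_mul, hX.eq,
        hXt.eq]
      noncomm_ring
    simp only [e, Finset.sum_add_distrib, Finset.sum_sub_distrib, ← Matrix.sum_mul,
      ← Matrix.mul_sum, ← h3, ← h4, h2, Matrix.mul_one]
    abel
  have hpos : 0 ≤ (expect ρ (tensorPower (dualMap Φ) (X * X) - Y * Y)).re := by
    have hp : (S.conjTranspose * (∑ k, (X * B k - B k * Y).conjTranspose * (X * B k - B k * Y)) *
        S).PosSemidef :=
      (Matrix.posSemidef_sum _ fun k _ =>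
        Matrix.posSemidef_conjTranspose_mul_self _).conjTranspose_mul_mul_same S
    rw [← key, ← hSρ, expect, Matrix.mul_assoc, Matrix.trace_mul_comm]
    rw [hS.1.eq] at hp
    exact (Complex.le_def.1 hp.trace_nonneg).1
  have e5 : expect ρ (tensorPower (dualMap Φ) (X * X) - Y * Y) =
      expect ρ (tensorPower (dualMap Φ) (X * X)) - expect ρ (Y * Y) := by
    simp [expect, Matrix.mul_sub]
  have e6 : ∀ Q : Matrix (Λ → Fin 2) (Λ → Fin 2) ℂ, expect ρ (Q + Q) / 2 = expect ρ Q := by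
    intro Q
    simp [expect, Matrix.mul_add]
  rw [e5, Complex.sub_re] at hpos
  rw [e6, e6, Complex.sub_re, Complex.sub_re]
  linarith

theorem IsKraus.opNorm_tensorPower_dualMap_le {Φ : QubitMap} (h : IsKraus Φ)
    {A : Matrix (Λ → Fin 2) (Λ → Fin 2) ℂ} (hm : (1 - A).PosSemidef) (hp : (1 + A).PosSemidef) :
    opNorm (tensorPower (dualMap Φ) A) ≤ 1 := by
  refine opNorm_le_one_of_abs_le_one ?_ ?_
  · have := h.posSemidef_tensorPower_dualMap hm
    rwa [sub_eq_add_neg, tensorPower_add, ← neg_one_smul ℂ, tensorPower_smul, neg_one_smul,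
      h.tensorPower_dualMap_one, ← sub_eq_add_neg] at this
  · have := h.posSemidef_tensorPower_dualMap hp
    rwa [tensorPower_add, h.tensorPower_dualMap_one] at this

end Dual

/-! ### Local noise and correlations between groups. -/

section Groups

variable {Λ Γ : Type*} [Fintype Λ] [DecidableEq Λ] [DecidableEq Γ] (grp : Λ → Γ)

/-- The dual of a trace-preserving map is unital, so the identity outside the group stays the
identity. -/
theorem IsKraus.tensorPower_dualMap_embed {Φ : QubitMap} (h : IsKraus Φ) (I : Γ)
    (A : Matrix (GroupBasis grp I) (GroupBasis grp I) ℂ) :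
    tensorPower (dualMap Φ) (embed grp I A) = embed grp I (tensorPower (dualMap Φ) A) := by
  induction A using kron_induction with
  | hk a =>
    rw [embed_kron, tensorPower_kron, tensorPower_kron, embed_kron]
    congr 1; ext1 i
    simp only [extendOne]
    split_ifs
    · rfl
    · exact h.dualMap_one
  | hadd A B hA hB => rw [embed_add, tensorPower_add, hA, hB, tensorPower_add, embed_add]
  | hsmul c A hA => rw [embed_smul, tensorPower_smul, hA, tensorPower_smul, embed_smul]

/-- The dual is not multiplicative in general, but on disjoint supports each qubit meets at most one
nontrivial factor. -/
theorem IsKraus.tensorPower_dualMap_embed_mul_embed {Φ : QubitMap} (h : IsKraus Φ) {I J : Γ}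
    (hIJ : I ≠ J) (A : Matrix (GroupBasis grp I) (GroupBasis grp I) ℂ)
    (B : Matrix (GroupBasis grp J) (GroupBasis grp J) ℂ) :
    tensorPower (dualMap Φ) (embed grp I A * embed grp J B) =
      embed grp I (tensorPower (dualMap Φ) A) * embed grp J (tensorPower (dualMap Φ) B) := by
  induction A using kron_induction with
  | hk a =>
    induction B using kron_induction with
    | hk b =>
      rw [embed_kron, embed_kron, kron_mul, tensorPower_kron, tensorPower_kron, tensorPower_kron,
        embed_kron, embed_kron, kron_mul]
      congr 1; ext1 i
      simp only [extendOne]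
      by_cases h1 : grp i = I
      · simp [h1, hIJ]
      · by_cases h2 : grp i = J
        · simp [h2, hIJ.symm]
        · simp [h1, h2, h.dualMap_one]
    | hadd A B hA hB =>
      rw [embed_add, Matrix.mul_add, tensorPower_add, hA, hB, tensorPower_add, embed_add,
        Matrix.mul_add]
    | hsmul c A hA =>
      rw [embed_smul, Matrix.mul_smul, tensorPower_smul, hA, tensorPower_smul, embed_smul,
        Matrix.mul_smul]
  | hadd A B hA hB =>
    rw [embed_add, Matrix.add_mul, tensorPower_add, hA, hB, tensorPower_add, embed_add,
      Matrix.add_mul]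
  | hsmul c A hA =>
    rw [embed_smul, Matrix.smul_mul, tensorPower_smul, hA, tensorPower_smul, embed_smul,
      Matrix.smul_mul]

theorem IsKraus.reduced_tensorPower {Φ : QubitMap} (h : IsKraus Φ) (I : Γ)
    (ρ : Matrix (Λ → Fin 2) (Λ → Fin 2) ℂ) :
    reduced grp I (tensorPower Φ ρ) = tensorPower Φ (reduced grp I ρ) := by
  rw [Matrix.ext_iff_trace_mul_right]
  intro A
  change expect _ _ = expect _ _
  rw [← expect_embed, expect_tensorPower, h.tensorPower_dualMap_embed, expect_embed,
    expect_tensorPower]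

theorem IsKraus.corr_tensorPower {Φ : QubitMap} (h : IsKraus Φ) {I J : Γ} (hIJ : I ≠ J)
    (ρ : Matrix (Λ → Fin 2) (Λ → Fin 2) ℂ)
    (A : Matrix (GroupBasis grp I) (GroupBasis grp I) ℂ)
    (B : Matrix (GroupBasis grp J) (GroupBasis grp J) ℂ) :
    corr (tensorPower Φ ρ) (embed grp I A) (embed grp J B) =
      corr ρ (embed grp I (tensorPower (dualMap Φ) A)) (embed grp J (tensorPower (dualMap Φ) B)) := by
  simp only [corr, expect_tensorPower, tensorPower_add, h.tensorPower_dualMap_embed,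
    h.tensorPower_dualMap_embed_mul_embed grp hIJ, h.tensorPower_dualMap_embed_mul_embed grp hIJ.symm]

theorem corr_smul_smul {n : Type*} [Fintype n] (ρ A B : Matrix n n ℂ) (c d : ℂ) :
    corr ρ (c • A) (d • B) = c * d * corr ρ A B := by
  simp only [corr, expect, Matrix.smul_mul, Matrix.mul_smul, Matrix.mul_add, Matrix.trace_add,
    Matrix.trace_smul, smul_eq_mul]
  ring

theorem opNorm_smul {n : Type*} [Fintype n] [DecidableEq n] (c : ℂ) (A : Matrix n n ℂ) :
    opNorm (c • A) = ‖c‖ * opNorm A := by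
  rw [opNorm, map_smul, norm_smul]; rfl

theorem eq_zero_of_opNorm_eq_zero {n : Type*} [Fintype n] [DecidableEq n] {A : Matrix n n ℂ}
    (h : opNorm A = 0) : A = 0 := by
  rw [opNorm, norm_eq_zero] at h
  simpa using h

/-- Bilinearity rescales to norm exactly 1; zero operators are treated apart, and boundedness makes
the supremum meaningful. -/
theorem norm_corr_le_groupCorr {ρ : Matrix (Λ → Fin 2) (Λ → Fin 2) ℂ} (hρ : IsState ρ) {I J : Γ}
    {A : Matrix (GroupBasis grp I) (GroupBasis grp I) ℂ}
    {B : Matrix (GroupBasis grp J) (GroupBasis grp J) ℂ} (hA : opNorm A ≤ 1) (hB : opNorm B ≤ 1) :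
    ‖corr ρ (embed grp I A) (embed grp J B)‖ ≤ groupCorr grp ρ I J := by
  have h0 : 0 ≤ groupCorr grp ρ I J := by
    refine Real.sSup_nonneg ?_
    rintro r ⟨A, B, -, -, rfl⟩
    exact norm_nonneg _
  have hbdd : BddAbove {r | ∃ (A : Matrix (GroupBasis grp I) (GroupBasis grp I) ℂ)
      (B : Matrix (GroupBasis grp J) (GroupBasis grp J) ℂ),
      opNorm A = 1 ∧ opNorm B = 1 ∧ r = ‖corr ρ (embed grp I A) (embed grp J B)‖} := by
    refine ⟨2, ?_⟩
    rintro r ⟨A, B, hA, hB, rfl⟩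
    exact norm_corr_le hρ (opNorm_embed_le_one _ _ hA.le) (opNorm_embed_le_one _ _ hB.le)
  have hA0 : 0 ≤ opNorm A := norm_nonneg _
  have hB0 : 0 ≤ opNorm B := norm_nonneg _
  rcases hA0.eq_or_lt with hA0 | hA0
  · rw [eq_zero_of_opNorm_eq_zero hA0.symm, embed_zero]
    simpa [corr, expect] using h0
  rcases hB0.eq_or_lt with hB0 | hB0
  · rw [eq_zero_of_opNorm_eq_zero hB0.symm, embed_zero]
    simpa [corr, expect] using h0
  have hn : ∀ {n : Type _} [Fintype n] [DecidableEq n] {A : Matrix n n ℂ}, 0 < opNorm A →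
      opNorm (((opNorm A)⁻¹ : ℂ) • A) = 1 := by
    intro n _ _ A hA
    rw [opNorm_smul, norm_inv, Complex.norm_real, Real.norm_eq_abs, abs_of_pos hA,
      inv_mul_cancel₀ hA.ne']
  have h1 := le_csSup hbdd ⟨_, _, hn hA0, hn hB0, rfl⟩
  rw [embed_smul, embed_smul, corr_smul_smul, norm_mul, norm_mul, norm_inv, norm_inv,
    Complex.norm_real, Complex.norm_real, Real.norm_eq_abs, Real.norm_eq_abs, abs_of_pos hA0,
    abs_of_pos hB0] at h1
  refine le_trans ?_ h1
  refine le_mul_of_one_le_left (norm_nonneg _) ?_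
  rw [← mul_inv]
  exact (one_le_inv₀ (by positivity)).2 (mul_le_one₀ hA hB0.le hB)

end Groups

theorem hasDerivAt_expect_re {n : Type*} [Fintype n] {ρ : ℝ → Matrix n n ℂ} {θ : ℝ}
    {D : Matrix n n ℂ} (hD : ∀ i j, HasDerivAt (fun t => ρ t i j) (D i j) θ) (X : Matrix n n ℂ) :
    HasDerivAt (fun t => (expect (ρ t) X).re) (expect D X).re θ := by
  have h1 : HasDerivAt (fun t => expect (ρ t) X) (expect D X) θ := by
    simp only [expect, Matrix.trace, Matrix.diag_apply, Matrix.mul_apply]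
    exact HasDerivAt.fun_sum fun i _ => HasDerivAt.fun_sum fun j _ => (hD i j).mul_const _
  exact Complex.reCLM.hasFDerivAt.comp_hasDerivAt θ h1

theorem expect_sum {n ι : Type*} [Fintype n] [Fintype ι] (ρ : Matrix n n ℂ) (A : ι → Matrix n n ℂ) :
    expect ρ (∑ i, A i) = ∑ i, expect ρ (A i) := by
  simp [expect, Matrix.mul_sum, Matrix.trace_sum]

theorem corr_sum_sum {n ι : Type*} [Fintype n] [Fintype ι] (ρ : Matrix n n ℂ)
    (A : ι → Matrix n n ℂ) :
    corr ρ (∑ i, A i) (∑ j, A j) = ∑ i, ∑ j, corr ρ (A i) (A j) := by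
  have e : (∑ i, A i) * (∑ j, A j) + (∑ i, A i) * (∑ j, A j) =
      ∑ i, ∑ j, (A i * A j + A j * A i) := by
    simp only [Finset.sum_add_distrib, Finset.sum_mul_sum]
    congr 1
    exact Finset.sum_comm
  rw [corr, e]
  simp only [corr, expect_sum, Finset.sum_sub_distrib, Finset.sum_mul_sum, Finset.sum_div]

/-! ### One group under noise. -/

section SingleGroup

variable {Λ : Type*} [Fintype Λ] [DecidableEq Λ]

/-- For a group with a large noiseless Fisher information, some Hermitian contraction has an
expectation that varies at a speed proportional to the size of the group, even with noise. -/
theorem IsNoisyEvolution.exists_group_observable {a K p : ℝ} (hK : 0 < K) (hp : 0 ≤ p)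
    (ha : 0 < a) (hM : 1 ≤ Fintype.card Λ) (hMp : (Fintype.card Λ : ℝ) * p ≤ a / (768 * K))
    {𝒩 : ℝ → QubitMap} (h : IsNoisyEvolution K p 𝒩) {ρ : Matrix (Λ → Fin 2) (Λ → Fin 2) ℂ}
    (hρ : IsState ρ) {θ F : ℝ} (hF : HasQFI (fun t => tensorPower (zRotation t) ρ) θ F)
    (haF : a * (Fintype.card Λ : ℝ) ^ 2 ≤ F) :
    ∃ O : Matrix (Λ → Fin 2) (Λ → Fin 2) ℂ, (1 - O).PosSemidef ∧ (1 + O).PosSemidef ∧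
      ∀ D : Matrix (Λ → Fin 2) (Λ → Fin 2) ℂ,
        (∀ x y, HasDerivAt (fun t => tensorPower (𝒩 t) ρ x y) (D x y) θ) →
        a * Fintype.card Λ / 16 ≤ (expect D O).re ∧
        (expect D O).re / 2 ≤ (expect (tensorPower (𝒩 θ) (diagComm totalZ ρ)) O).re := by
  obtain ⟨L, ⟨hL, hLD⟩, rfl⟩ := hF
  set M : ℝ := (Fintype.card Λ : ℝ) with hMdef
  have hM1 : 1 ≤ M := by rw [hMdef]; exact_mod_cast hM
  have hM0 : 0 < M := by linarith
  have hD : diagComm totalZ (tensorPower (zRotation θ) ρ) =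
      (1 / 2 : ℂ) • (L * tensorPower (zRotation θ) ρ + tensorPower (zRotation θ) ρ * L) := by
    ext x y
    exact (hasDerivAt_tensorPower_zRotation θ ρ x y).unique (hLD x y)
  obtain ⟨O, hO1, hO2, hO⟩ := exists_observable_of_fisher
    ((isKraus_zRotation θ).isState_tensorPower hρ).1 hM0 abs_totalZ_le hL hD
  refine ⟨O, hO1, hO2, fun D hDd => ?_⟩
  obtain ⟨D', hD', hb⟩ := h.exists_hasDerivAt (mul_nonneg hK.le hp) hρ θ
  have hDD : D = D' := by
    ext x y
    exact (hDd x y).unique (hD' x y)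
  subst hDD
  obtain ⟨hb1, hb2⟩ := hb O (opNorm_le_one_of_abs_le_one hO1 hO2)
  have h1 : a * M / 8 ≤ (expect (diagComm totalZ (tensorPower (zRotation θ) ρ)) O).re := by
    refine le_trans ?_ hO
    rw [div_le_div_iff₀ (by norm_num) (by positivity)]
    nlinarith
  -- The constant 768 = 24 · 32 makes the noise error at most a quarter of the noiseless speed aM/8.
  have hKMp : 24 * M * (K * p) ≤ a / 32 := by
    have := mul_le_mul_of_nonneg_left hMp (by positivity : 0 ≤ 24 * K)
    calc 24 * M * (K * p) = 24 * K * (M * p) := by ring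
      _ ≤ _ := this
      _ = a / 32 := by field_simp; norm_num
  have h2 := (Complex.abs_re_le_norm _).trans hb1
  have h3 := (Complex.abs_re_le_norm _).trans hb2
  rw [Complex.sub_re] at h2 h3
  have h4 := (abs_le.1 h2).1
  have h5 := (abs_le.1 h3).2
  rw [← hMdef] at h4 h5
  have h6 : 24 * M ^ 2 * (K * p) ≤ a * M / 32 := by
    calc 24 * M ^ 2 * (K * p) = 24 * M * (K * p) * M := by ring
      _ ≤ a / 32 * M := by gcongr
      _ = a * M / 32 := by ring
  -- The error a/32 of the Heisenberg form is at most half of the speed aM/16, since M ≥ 1.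
  have h7 : a ≤ a * M := le_mul_of_one_le_right ha.le hM1
  constructor <;> linarith

end SingleGroup

/-! ### Summing over groups: the generator and the variances. -/

section ManyGroups

variable {Λ Γ : Type*} [Fintype Λ] [DecidableEq Λ] [Fintype Γ] [DecidableEq Γ] {grp : Λ → Γ}

theorem hasDerivAt_reduced {σ : ℝ → Matrix (Λ → Fin 2) (Λ → Fin 2) ℂ} {θ : ℝ}
    {D : Matrix (Λ → Fin 2) (Λ → Fin 2) ℂ}
    (hD : ∀ x y, HasDerivAt (fun t => σ t x y) (D x y) θ) (I : Γ) (s t : GroupBasis grp I) :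
    HasDerivAt (fun t' => reduced grp I (σ t') s t) (reduced grp I D s t) θ := by
  simp only [reduced, Matrix.of_apply]
  exact HasDerivAt.fun_sum fun u _ => hD _ _

/-- Commutators with Z outside the group vanish under the partial trace. The proof differentiates,
at t = 0, the fact that reduction commutes with the rotations. -/
theorem reduced_diagComm_totalZ (I : Γ) (ρ : Matrix (Λ → Fin 2) (Λ → Fin 2) ℂ) :
    reduced grp I (diagComm totalZ ρ) = diagComm totalZ (reduced grp I ρ) := by
  have h0 : ∀ {Λ' : Type _} [Fintype Λ'] [DecidableEq Λ'] (ρ : Matrix (Λ' → Fin 2) (Λ' → Fin 2) ℂ),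
      tensorPower (zRotation 0) ρ = ρ := by
    intro Λ' _ _ ρ
    ext x y
    simp [tensorPower_zRotation_apply]
  ext s t
  have h1 := hasDerivAt_reduced (hasDerivAt_tensorPower_zRotation 0 ρ) I s t
  simp only [(isKraus_zRotation _).reduced_tensorPower] at h1
  have h2 := h1.unique (hasDerivAt_tensorPower_zRotation 0 (reduced grp I ρ) s t)
  rwa [h0, h0] at h2

theorem sum_groups {R : Type*} [AddCommMonoid R] (f : Λ → R) :
    ∑ I, ∑ i : {i // grp i = I}, f i = ∑ i, f i := by
  rw [← (Equiv.sigmaFiberEquiv grp).sum_comp, Fintype.sum_sigma]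
  rfl

theorem diagonal_totalZ_eq_sum_embed :
    Matrix.diagonal (fun x : Λ → Fin 2 => (totalZ x : ℂ)) =
      ∑ I, embed grp I (Matrix.diagonal fun s => (totalZ s : ℂ)) := by
  ext x y
  rw [Matrix.sum_apply]
  by_cases hxy : x = y
  · subst hxy
    simp only [Matrix.diagonal_apply_eq, embed, Matrix.of_apply, implies_true, if_true]
    rw [← Complex.ofReal_sum]
    congr 1
    exact (sum_groups (grp := grp) fun i => zSign (x i)).symm
  · rw [Matrix.diagonal_apply_ne _ hxy]
    symm
    refine Finset.sum_eq_zero fun I _ => ?_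
    simp only [embed, Matrix.of_apply]
    split_ifs with h
    · refine Matrix.diagonal_apply_ne _ fun h' => hxy ?_
      ext1 i
      by_cases hi : grp i = I
      · exact congrFun h' ⟨i, hi⟩
      · exact h i hi
    · rfl

/-- In each row, at most `s` neighbouring groups contribute at most 2 each, and the remaining ones
at most `c` in total. -/
theorem variance_sum_embed_le {σ : Matrix (Λ → Fin 2) (Λ → Fin 2) ℂ} (hσ : IsState σ)
    {A : (I : Γ) → Matrix (GroupBasis grp I) (GroupBasis grp I) ℂ} (hA : ∀ I, opNorm (A I) ≤ 1)
    {S : Γ → Finset Γ} {s : ℕ} (hS : ∀ I, (S I).card ≤ s) {g : Γ → Γ → ℝ} {c : ℝ}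
    (hg : ∀ I, ∀ J ∈ (S I)ᶜ, ‖corr σ (embed grp I (A I)) (embed grp J (A J))‖ ≤ g I J)
    (hc : ∀ I, ∑ J ∈ (S I)ᶜ, g I J ≤ c) :
    variance σ (∑ I, embed grp I (A I)) ≤ Fintype.card Γ * (2 * s + c) := by
  rw [variance, corr_sum_sum, Complex.re_sum]
  refine (Finset.sum_le_sum fun I _ => ?_).trans (?_ : ∑ I : Γ, (2 * s + c : ℝ) ≤ _)
  · refine (Complex.re_le_norm _).trans ((norm_sum_le _ _).trans ?_)
    rw [← Finset.sum_add_sum_compl (S I)]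
    refine add_le_add ?_ ((Finset.sum_le_sum (hg I)).trans (hc I))
    refine (Finset.sum_le_card_nsmul _ _ 2 fun J _ =>
      norm_corr_le hσ (opNorm_embed_le_one _ _ (hA I)) (opNorm_embed_le_one _ _ (hA J))).trans ?_
    rw [nsmul_eq_mul, mul_comm]
    have : ((S I).card : ℝ) ≤ s := by exact_mod_cast hS I
    linarith
  · rw [Finset.sum_const, Finset.card_univ, nsmul_eq_mul]

/-- Within each group ∑ Z_i is M times a contraction, so the correlation bound applies to the
generator as well. -/
theorem variance_totalZ_le {ρ : Matrix (Λ → Fin 2) (Λ → Fin 2) ℂ} (hρ : IsState ρ) {M : ℕ}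
    (hM : 0 < M) (hcard : ∀ I, Fintype.card {i // grp i = I} = M)
    {S : Γ → Finset Γ} {s : ℕ} (hS : ∀ I, (S I).card ≤ s) {c : ℝ}
    (hc : ∀ I, ∑ J ∈ (S I)ᶜ, groupCorr grp ρ I J ≤ c) :
    variance ρ (Matrix.diagonal fun x => (totalZ x : ℂ)) ≤
      (M : ℝ) ^ 2 * (Fintype.card Γ * (2 * s + c)) := by
  have hM' : (0 : ℝ) < M := by exact_mod_cast hM
  let A : (I : Γ) → Matrix (GroupBasis grp I) (GroupBasis grp I) ℂ :=
    fun I => Matrix.diagonal fun x => ((totalZ x / M : ℝ) : ℂ)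
  have hA : ∀ I, opNorm (A I) ≤ 1 := by
    intro I
    rw [opNorm_le_one_iff]
    have : 1 - (A I).conjTranspose * A I =
        Matrix.diagonal fun x => ((1 - (totalZ x / M) ^ 2 : ℝ) : ℂ) := by
      rw [(isHermitian_diagonal_ofReal _).eq, Matrix.diagonal_mul_diagonal, ← Matrix.diagonal_one,
        Matrix.diagonal_sub]
      congr 1; ext x
      push_cast; ring
    rw [this]
    refine posSemidef_diagonal_ofReal fun x => sub_nonneg.2 ?_
    rw [← sq_abs, abs_div, abs_of_pos hM']
    refine pow_le_one₀ (by positivity) ((div_le_one hM').2 ?_)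
    exact (abs_totalZ_le x).trans (by rw [hcard])
  have hsum : Matrix.diagonal (fun x : Λ → Fin 2 => (totalZ x : ℂ)) =
      (M : ℂ) • ∑ I, embed grp I (A I) := by
    rw [diagonal_totalZ_eq_sum_embed (grp := grp), Finset.smul_sum]
    refine Finset.sum_congr rfl fun I _ => ?_
    rw [← embed_smul, ← Matrix.diagonal_smul]
    congr 2; ext x
    have : (M : ℂ) ≠ 0 := by exact_mod_cast hM'.ne'
    simp only [Pi.smul_apply, smul_eq_mul]
    push_cast
    field_simp
  have h := variance_sum_embed_le hρ hA hS
    (fun I J _ => norm_corr_le_groupCorr grp hρ (hA I) (hA J)) hc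
  rw [variance] at h ⊢
  rw [hsum, corr_smul_smul, show (M : ℂ) * M = ((M ^ 2 : ℝ) : ℂ) by push_cast; ring,
    Complex.re_ofReal_mul]
  gcongr

end ManyGroups

/-! ### Assembling the global observable. -/

/-- The main estimate, with explicit constants. -/
theorem IsNoisyEvolution.exists_observable {a K b C p θ : ℝ} {s N M G : ℕ} (ha : 0 < a)
    (hK : 0 < K) (hp : 0 ≤ p) (hMN : M < N) (hMp : (M : ℝ) * p ≤ a / (768 * K))
    {grp : Fin N → Fin G} {ρ : Matrix (Fin N → Fin 2) (Fin N → Fin 2) ℂ}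
    {𝒩 : ℝ → QubitMap} {S : Fin G → Finset (Fin G)}
    (hcard : ∀ I, Fintype.card {i // grp i = I} = M) (hρ : IsState ρ)
    (hN : IsNoisyEvolution K p 𝒩)
    (hF : ∀ I, ∃ F, HasQFI (fun t => reduced grp I (tensorPower (zRotation t) ρ)) θ F ∧
      a * (M : ℝ) ^ 2 ≤ F ∧ F ≤ b * (M : ℝ) ^ 2)
    (hS : ∀ I, I ∈ S I ∧ (S I).card ≤ s ∧
      ∑ J ∈ (S I)ᶜ, groupCorr grp ρ I J ≤ C / (M : ℝ) ^ 2) :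
    ∃ O : (I : Fin G) → Matrix (GroupBasis grp I) (GroupBasis grp I) ℂ,
      (∀ I, (O I).IsHermitian) ∧
      ∃ d v F : ℝ,
        HasDerivAt
          (fun t => (expect (tensorPower (𝒩 t) ρ) (∑ I, embed grp I (O I))).re) d θ ∧
        variance (tensorPower (𝒩 θ) ρ) (∑ I, embed grp I (O I)) = v ∧ 0 < v ∧
        HasQFI (fun t => tensorPower (𝒩 t) ρ) θ F ∧
        d ^ 2 / v ≤ F ∧
        a ^ 2 / (256 * (2 * s + |C| + 1)) * (N * M) ≤ d ^ 2 / v ∧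
        d ^ 2 / v ≤ 16 * (2 * s + |C| + 1) * (N * M) := by
  set B : ℝ := 2 * s + |C| + 1 with hB
  have hB0 : 0 < B := by positivity
  -- Counting qubits by groups. With M < N this excludes M = 0 and G = 0.
  have hGM : G * M = N := by
    have := sum_groups (grp := grp) (fun _ => 1)
    simpa [hcard] using this
  have hM : 0 < M := by
    rcases Nat.eq_zero_or_pos M with rfl | h
    · simp at hGM; omega
    · exact h
  have hG : 0 < G := by
    rcases Nat.eq_zero_or_pos G with rfl | h
    · simp at hGM; omega
    · exact h
  have hM0 : (1 : ℝ) ≤ M := by exact_mod_cast hM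
  have hG0 : (0 : ℝ) < G := by exact_mod_cast hG
  have hGM' : (N : ℝ) = G * M := by exact_mod_cast hGM.symm
  have hKr : ∀ t, IsKraus (𝒩 t) := fun t => (hN t).1.isKraus
  have hCM : C / (M : ℝ) ^ 2 ≤ |C| :=
    (le_abs_self _).trans (by
      rw [abs_div, abs_of_nonneg (by positivity : (0 : ℝ) ≤ (M : ℝ) ^ 2)]
      exact div_le_self (abs_nonneg _) (one_le_pow₀ hM0))
  have hScard : ∀ I, (S I).card ≤ s := fun I => (hS I).2.1
  have hSc : ∀ I, ∑ J ∈ (S I)ᶜ, groupCorr grp ρ I J ≤ |C| := fun I => (hS I).2.2.trans hCM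
  have hobs : ∀ I, ∃ O : Matrix (GroupBasis grp I) (GroupBasis grp I) ℂ,
      (1 - O).PosSemidef ∧ (1 + O).PosSemidef ∧
      ∀ D : Matrix (GroupBasis grp I) (GroupBasis grp I) ℂ,
        (∀ x y, HasDerivAt (fun t => tensorPower (𝒩 t) (reduced grp I ρ) x y) (D x y) θ) →
        a * M / 16 ≤ (expect D O).re ∧ (expect D O).re / 2 ≤
          (expect (tensorPower (𝒩 θ) (diagComm totalZ (reduced grp I ρ))) O).re := by
    intro I
    obtain ⟨F, hF1, hF2, -⟩ := hF I
    simp only [(isKraus_zRotation _).reduced_tensorPower] at hF1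
    have := hN.exists_group_observable (Λ := {i // grp i = I}) hK hp ha (by rw [hcard]; exact hM)
      (by rw [hcard]; exact hMp) (isState_reduced grp I hρ) hF1 (by rw [hcard]; exact hF2)
    rwa [hcard] at this
  choose O hO1 hO2 hO using hobs
  have hOn : ∀ I, opNorm (O I) ≤ 1 := fun I => opNorm_le_one_of_abs_le_one (hO1 I) (hO2 I)
  have hOH : ∀ I, (O I).IsHermitian := by
    intro I
    have := (hO2 I).1.sub (Matrix.isHermitian_one (α := ℂ))
    simpa using this
  set X := ∑ I, embed grp I (O I) with hX
  have hXH : X.IsHermitian := by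
    rw [Matrix.IsHermitian, hX, Matrix.conjTranspose_sum]
    exact Finset.sum_congr rfl fun I _ => by rw [← embed_conjTranspose, (hOH I).eq]
  obtain ⟨D, hD, -⟩ := hN.exists_hasDerivAt (mul_nonneg hK.le hp) hρ θ
  have hst : ∀ t, IsState (tensorPower (𝒩 t) ρ) := fun t => (hKr t).isState_tensorPower hρ
  obtain ⟨L, hL, hLD⟩ := exists_sld (fun t => (hst t).1) hD
  have hDtr : D.trace = 0 := by
    have h1 : HasDerivAt (fun t => (tensorPower (𝒩 t) ρ).trace) D.trace θ := by
      simp only [Matrix.trace, Matrix.diag_apply]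
      exact HasDerivAt.fun_sum fun x _ => hD x x
    simp only [fun t => (hst t).2] at h1
    exact h1.unique (hasDerivAt_const _ _)
  have hCR := sq_trace_sld_mul_le_variance (hst θ) hL hXH (by rw [← hLD]; exact hDtr)
  rw [← hLD] at hCR
  change (expect D X).re ^ 2 ≤ _ at hCR
  have hgroup : ∀ I, a * M / 16 ≤ (expect D (embed grp I (O I))).re ∧
      (expect D (embed grp I (O I))).re / 2 ≤
        (expect (diagComm totalZ ρ) (tensorPower (dualMap (𝒩 θ)) (embed grp I (O I)))).re := by
    intro I
    rw [expect_embed, (hKr θ).tensorPower_dualMap_embed, expect_embed, reduced_diagComm_totalZ,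
      ← expect_tensorPower]
    refine hO I _ fun x y => ?_
    have := hasDerivAt_reduced hD I x y
    simpa only [fun t => (hKr t).reduced_tensorPower grp I ρ] using this
  have hXt : tensorPower (dualMap (𝒩 θ)) X =
      ∑ I, tensorPower (dualMap (𝒩 θ)) (embed grp I (O I)) := by
    rw [hX]
    exact map_sum (⟨⟨tensorPower (dualMap (𝒩 θ)), tensorPower_add _⟩, tensorPower_smul _⟩ :
      Matrix (Fin N → Fin 2) (Fin N → Fin 2) ℂ →ₗ[ℂ] _) _ _
  set d := (expect D X).re with hd
  have hd1 : G * (a * M / 16) ≤ d := by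
    rw [hd, hX, expect_sum, Complex.re_sum]
    have := Finset.card_nsmul_le_sum Finset.univ
      (fun I => (expect D (embed grp I (O I))).re) (a * M / 16) fun I _ => (hgroup I).1
    simpa using this
  have hd0 : 0 < d := lt_of_lt_of_le (by positivity) hd1
  have hd2 : d / 2 ≤ (expect (diagComm totalZ ρ) (tensorPower (dualMap (𝒩 θ)) X)).re := by
    rw [hXt, hd, hX, expect_sum, expect_sum, Complex.re_sum, Complex.re_sum, Finset.sum_div]
    exact Finset.sum_le_sum fun I _ => (hgroup I).2
  set v := variance (tensorPower (𝒩 θ) ρ) X with hv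
  -- Cramér-Rao reads d² ≤ F v with F ≥ 0, so v ≤ 0 would contradict d > 0.
  have hv0 : 0 < v := by
    by_contra! hle
    have h1 : 0 ≤ (expect (tensorPower (𝒩 θ) ρ) (L * L)).re := by
      obtain ⟨Q, hQ, hQρ⟩ := exists_posSemidef_sqrt (hst θ).1
      rw [← hQρ, ← frobSq_mul_sqrt hL hQ.1]
      exact frobSq_nonneg _
    nlinarith [mul_nonneg h1 (neg_nonneg.2 hle), sq_pos_of_pos hd0]
  have hvB : v ≤ G * B := by
    have h1 := variance_sum_embed_le (hst θ) hOn hScard (g := groupCorr grp ρ) (c := |C|)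
      (fun I J hJ => by
        -- I belongs to its own neighbourhood, so only distinct groups remain; for these the noise
        -- can be moved onto the observables.
        have hIJ : I ≠ J := by
          rintro rfl
          exact (Finset.mem_compl.1 hJ) (hS I).1
        rw [(hKr θ).corr_tensorPower grp hIJ]
        exact norm_corr_le_groupCorr grp hρ
          ((hKr θ).opNorm_tensorPower_dualMap_le (hO1 I) (hO2 I))
          ((hKr θ).opNorm_tensorPower_dualMap_le (hO1 J) (hO2 J))) hSc
    rw [Fintype.card_fin] at h1
    refine h1.trans (mul_le_mul_of_nonneg_left ?_ hG0.le)
    rw [hB]; linarith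
  -- 16 = 4 · 4: one 4 from d ≤ 2·`main`, the other from Robertson's relation applied in the initial
  -- state ρ.
  have hup : d ^ 2 ≤ 16 * B * (N * M) * v := by
    have h1 := sq_expect_diagComm_le hρ ((hKr θ).isHermitian_tensorPower_dualMap hXH) totalZ
    have h2 := variance_totalZ_le hρ hM hcard hScard hSc
    have h3 := (hKr θ).variance_dualMap_le hρ.1 hXH
    rw [Fintype.card_fin] at h2
    set main := (expect (diagComm totalZ ρ) (tensorPower (dualMap (𝒩 θ)) X)).re
    have h4 : 0 ≤ variance ρ (Matrix.diagonal fun x => (totalZ x : ℂ)) := by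
      have hH := isHermitian_diagonal_ofReal (totalZ (Λ := Fin N))
      obtain ⟨Q, hQ, hQρ⟩ := exists_posSemidef_sqrt hρ.1
      rw [variance_eq_expect_centered hρ hH, ← hQρ,
        ← frobSq_mul_sqrt (isHermitian_sub_smul_one hH _) hQ.1]
      exact frobSq_nonneg _
    have h5 : variance ρ (Matrix.diagonal fun x => (totalZ x : ℂ)) ≤ (M : ℝ) ^ 2 * (G * B) := by
      refine h2.trans ?_
      gcongr
      rw [hB]; linarith
    have h6 : d ^ 2 ≤ 4 * main ^ 2 := by
      have := pow_le_pow_left₀ (by positivity) hd2 2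
      linarith
    calc d ^ 2 ≤ 4 * main ^ 2 := h6
      _ ≤ 4 * (4 * (variance ρ (Matrix.diagonal fun x => (totalZ x : ℂ)) *
          variance ρ (tensorPower (dualMap (𝒩 θ)) X))) := by linarith
      _ ≤ 4 * (4 * (variance ρ (Matrix.diagonal fun x => (totalZ x : ℂ)) * v)) := by gcongr
      _ ≤ 4 * (4 * ((M : ℝ) ^ 2 * (G * B) * v)) := by gcongr
      _ = 16 * B * (N * M) * v := by rw [hGM']; ring
  refine ⟨O, hOH, d, v, _, hasDerivAt_expect_re hD X, rfl, hv0, ⟨L, ⟨hL, ?_⟩, rfl⟩, ?_, ?_, ?_⟩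
  · intro i j
    rw [← hLD]
    exact hD i j
  · rw [div_le_iff₀ hv0]; exact hCR
  · rw [le_div_iff₀ hv0]
    calc a ^ 2 / (256 * B) * (N * M) * v ≤ a ^ 2 / (256 * B) * (N * M) * (G * B) := by gcongr
      _ = (G * (a * M / 16)) ^ 2 := by rw [hGM']; field_simp; ring
      _ ≤ d ^ 2 := pow_le_pow_left₀ (by positivity) hd1 2
  · rw [div_le_iff₀ hv0]; exact hup

end NoisyMetrology
end

open NoisyMetrology in
theorem theorem1 (a K : ℝ) (ha : 0 < a) (hK : 0 < K) :
    ∃ c_no : ℝ, 0 < c_no ∧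
      ∀ (b C : ℝ) (s : ℕ), ∃ c₁ c₂ : ℝ, 0 < c₁ ∧ 0 < c₂ ∧
        ∀ (p : ℝ) (N M G : ℕ) (grp : Fin N → Fin G)
          (ρ : Matrix (Fin N → Fin 2) (Fin N → Fin 2) ℂ)
          (𝒩 : ℝ → QubitMap) (S : Fin G → Finset (Fin G)) (θ : ℝ),
          0 ≤ p → M < N → (M : ℝ) * p ≤ c_no →
          (∀ I, Fintype.card {i // grp i = I} = M) →
          IsState ρ →
          IsNoisyEvolution K p 𝒩 →
          (∀ I, ∃ F, HasQFI (fun t => reduced grp I (tensorPower (zRotation t) ρ)) θ F ∧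
            a * (M : ℝ) ^ 2 ≤ F ∧ F ≤ b * (M : ℝ) ^ 2) →
          (∀ I, I ∈ S I ∧ (S I).card ≤ s ∧
            ∑ J ∈ (S I)ᶜ, groupCorr grp ρ I J ≤ C / (M : ℝ) ^ 2) →
          ∃ O : (I : Fin G) → Matrix (GroupBasis grp I) (GroupBasis grp I) ℂ,
            (∀ I, (O I).IsHermitian) ∧
            ∃ d v F : ℝ,
              HasDerivAt
                (fun t => (expect (tensorPower (𝒩 t) ρ) (∑ I, embed grp I (O I))).re) d θ ∧
              variance (tensorPower (𝒩 θ) ρ) (∑ I, embed grp I (O I)) = v ∧ 0 < v ∧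
              HasQFI (fun t => tensorPower (𝒩 t) ρ) θ F ∧
              d ^ 2 / v ≤ F ∧
              c₁ * (N * M) ≤ d ^ 2 / v ∧ d ^ 2 / v ≤ c₂ * (N * M) := by
  -- The threshold depends on `a` and `K` only, as the order of quantifiers requires.
  refine ⟨a / (768 * K), by positivity, fun b C s => ⟨a ^ 2 / (256 * (2 * s + |C| + 1)),
    16 * (2 * s + |C| + 1), by positivity, by positivity, ?_⟩⟩
  intro p N M G grp ρ 𝒩 S θ hp hMN hMp hcard hρ hN hF hS
  exact hN.exists_observable ha hK hp hMN hMp hcard hρ hF hS
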